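/- Let $\mathcal{A}=\{1,2,3\}$ and let $\mathcal{C}=\{c_1,c_2\}$, where $c_1,c_2$ are the substitutions (endomorphisms of the free monoid $\mathcal{A}^*$) $$c_1:\ 1\mapsto 1,\ 2\mapsto 13,\ 3\mapsto 2,\qquad c_2:\ 1\mapsto 2,\ 2\mapsto 13,\ 3\mapsto 3.$$ An infinite word $\mathbf{w}\in\mathcal{A}^{\mathbb{N}}$ is called a primitive $\mathcal{C}$-adic word if there are a sequence $(\tau_n)_{n\in\mathbb{N}}\in\mathcal{C}^{\mathbb{N}}$ and a sequence of letters $(a_n)_{n\in\mathbb{N}}$ such that $\mathbf{w}=\lim_{n\to\infty}\tau_0\tau_1\cdots\tau_{n-1}(a_n)$, and such that for every $r\ge 0$ there is $r'>r$ for which all letters of $\mathcal{A}$ occur in each of the words $\tau_r\tau_{r+1}\cdots\tau_{r'-1}(a)$, $a\in\mathcal{A}$. For a factor $u$ of $\mathbf{w}$ let $E(u)=\{(a,b)\in\mathcal{A}\times\mathcal{A} : aub \text{ is a factor of } \mathbf{w}\}$. The extension graph of $u$ is the undirected bipartite graph whose vertex set is the disjoint union of the first projection $\pi_1(E(u))$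 and the second projection $\pi_2(E(u))$, with edge set $E(u)$; the factor $u$ is bispecial if both projections have more than one element. The word $\mathbf{w}$ is uniformly recurrent if for every factor $u$ there is $N$ such that $u$ occurs in every factor of $\mathbf{w}$ of length $N$. 1. Every primitive $\mathcal{C}$-adic word is a uniformly recurrent tree word; that is, it is uniformly recurrent and the extension graph of each of its bispecial factors is a tree. 2. In particular, every primitive $\mathcal{C}$-adic word has factor complexity $p(n)=2n+1$ for all $n\ge 0$, where $p(n)$ is the number of its factors of length $n$. 3. For every vector $\mathbf{x}=(x_1,x_2,x_3)\in\mathbb{R}_{\ge 0}^3$ with $x_1+x_2+x_3=1$ whose entries are linearly independent over $\mathbb{Q}$, there is a primitive $\mathcal{C}$-adic word $\mathbf{w}$ (hence one of factor complexity $2n+1$) in which, for each $i\in\{1,2,3\}$, the letter $i$ has frequency $x_i$; that is, the number of occurrences of $i$ among the first $n$ letters of $\mathbf{w}$, divided by $n$, tends to $x_i$ as $n\to\infty$. -/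

import Mathlib

open Filter Topology

namespace SAdic

/-- A substitution on the alphabet `A`: the endomorphism of the free monoid `A*` (words are lists)
given by the images of the letters; it acts on a word by concatenating the images of its letters. -/
abbrev Substitution (A : Type*) := A → List A

/-- `compose s r k u` is the word `τ_r τ_{r+1} ⋯ τ_{r+k-1} (u)`, where `τ_n = s n`. -/
def compose {A : Type*} (s : ℕ → Substitution A) (r : ℕ) : ℕ → List A → List A
  | 0, u => u
  | k + 1, u => compose s r k (u.flatMap (s (r + k)))

/-- The factor `w_i w_{i+1} ⋯ w_{i+n-1}` of the infinite word `w`. -/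
def window {A : Type*} (w : ℕ → A) (i n : ℕ) : List A :=
  (List.range n).map fun k => w (i + k)

/-- `w = lim_{n → ∞} τ_0 τ_1 ⋯ τ_{n-1} (a_n)`: every finite prefix of the infinite word `w` is a
prefix of `τ_0 ⋯ τ_{n-1} (a_n)` for all large `n`. -/
def IsRepresentation {A : Type*} (s : ℕ → Substitution A) (a : ℕ → A) (w : ℕ → A) : Prop :=
  ∀ L : ℕ, ∀ᶠ n in atTop, window w 0 L <+: compose s 0 n [a n]

/-- A directive sequence is primitive if for every `r` there is `r' > r` such that all letters
occur in all the words `τ_r ⋯ τ_{r'-1} (a)`, where `a` is a letter. -/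
def IsPrimitive {A : Type*} (s : ℕ → Substitution A) : Prop :=
  ∀ r : ℕ, ∃ r' > r, ∀ a b : A, b ∈ compose s r (r' - r) [a]

/-- `w` is a primitive `S`-adic word: it has an `S`-adic representation whose directive sequence
is primitive. -/
def IsPrimitiveSAdic {A : Type*} (S : Set (Substitution A)) (w : ℕ → A) : Prop :=
  ∃ (s : ℕ → Substitution A) (a : ℕ → A),
    (∀ n, s n ∈ S) ∧ IsPrimitive s ∧ IsRepresentation s a w

/-- The set of (finite) factors of an infinite word. -/
def factors {A : Type*} (w : ℕ → A) : Set (List A) :=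
  {u | ∃ i : ℕ, window w i u.length = u}

/-- Factor complexity: the number of factors of length `n`. -/
noncomputable def complexity {A : Type*} (w : ℕ → A) (n : ℕ) : ℕ :=
  {u ∈ factors w | u.length = n}.ncard

/-- Uniform recurrence: for every factor `u` there is `N` such that `u` occurs in every factor
of length `N`. -/
def IsUniformlyRecurrent {A : Type*} (w : ℕ → A) : Prop :=
  ∀ u ∈ factors w, ∃ N : ℕ, ∀ v ∈ factors w, v.length = N → u <:+: v

/-- The extension set `E(u, w) = {(a, b) | a u b is a factor of w}`. -/
def extensionSet {A : Type*} (w : ℕ → A) (u : List A) : Set (A × A) :=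
  {p | p.1 :: (u ++ [p.2]) ∈ factors w}

/-- The left extensions of `u`, the first projection of the extension set. -/
def leftExtensions {A : Type*} (w : ℕ → A) (u : List A) : Set A :=
  Prod.fst '' extensionSet w u

/-- The right extensions of `u`, the second projection of the extension set. -/
def rightExtensions {A : Type*} (w : ℕ → A) (u : List A) : Set A :=
  Prod.snd '' extensionSet w u

/-- A factor is bispecial if it has more than one left and more than one right extension. -/
def IsBispecial {A : Type*} (w : ℕ → A) (u : List A) : Prop :=
  u ∈ factors w ∧ (leftExtensions w u).Nontrivial ∧ (rightExtensions w u).Nontrivial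

/-- The extension graph of `u`: the undirected bipartite graph on the disjoint union of the left
extensions and the right extensions whose edges are the pairs in the extension set. -/
def extensionGraph {A : Type*} (w : ℕ → A) (u : List A) :
    SimpleGraph (leftExtensions w u ⊕ rightExtensions w u) where
  Adj x y :=
    (∃ a b, x = Sum.inl a ∧ y = Sum.inr b ∧ ((a : A), (b : A)) ∈ extensionSet w u) ∨
    (∃ a b, x = Sum.inr b ∧ y = Sum.inl a ∧ ((a : A), (b : A)) ∈ extensionSet w u)
  symm := ⟨by
    rintro x y (⟨a, b, hx, hy, h⟩ | ⟨a, b, hx, hy, h⟩)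
    · exact Or.inr ⟨a, b, hy, hx, h⟩
    · exact Or.inl ⟨a, b, hy, hx, h⟩⟩
  loopless := ⟨by
    rintro x (⟨a, b, hx, hy, -⟩ | ⟨a, b, hx, hy, -⟩)
    · exact Sum.inl_ne_inr (hx.symm.trans hy)
    · exact Sum.inl_ne_inr (hy.symm.trans hx)⟩

/-- A tree word: the extension graph of every bispecial factor is a tree. -/
def IsTreeWord {A : Type*} (w : ℕ → A) : Prop :=
  ∀ u, IsBispecial w u → (extensionGraph w u).IsTree

/-- The letter `a` has frequency `f` in `w`: the proportion of `a` among the first `n` letters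
tends to `f`. -/
def HasFrequency {A : Type*} [DecidableEq A] (w : ℕ → A) (a : A) (f : ℝ) : Prop :=
  Tendsto (fun n : ℕ => ((window w 0 n).count a : ℝ) / (n : ℝ)) atTop (𝓝 f)

/-- The substitution `1 ↦ 1, 2 ↦ 13, 3 ↦ 2`; the letters `1, 2, 3` are `0, 1, 2 : Fin 3`. -/
def c₁ : Substitution (Fin 3) := ![[0], [0, 2], [1]]

/-- The substitution `1 ↦ 2, 2 ↦ 13, 3 ↦ 3`; the letters `1, 2, 3` are `0, 1, 2 : Fin 3`. -/
def c₂ : Substitution (Fin 3) := ![[1], [0, 2], [2]]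

/-- The set `𝒞 = {c₁, c₂}`. -/
def cassaigneSet : Set (Substitution (Fin 3)) := {c₁, c₂}

end SAdic

/-! Letters are written 0, 1, 2 as in the code. Primitivity makes the factors of the word the first
term of a chain of languages, each generated from the next one by `c₁` or `c₂` (`IsChain`). It also
gives uniform recurrence: every factor occurs in all sufficiently deep blocks, and every long enough
factor contains a complete block.

Tree property: a nonempty word with several extensions on each side is, at a rank governed by `c₁`,
an image under `c₁`, and its extension matrix comes from that of a shorter preimage by merging two
columns, dropping a column, or no change. Being a tree is not by itself stable under these moves.
The invariant `IsGoodTree` adds that columns 0, 1 and rows 1, 2 have common neighbours, which is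
exactly what the moves consume. Reversal combined with the exchange of 0 and 2 swaps `c₁` and `c₂`,
so ranks governed by `c₂` follow by symmetry. The empty word is settled by inspecting three
consecutive ranks, and `IsChain.isGoodTree_of_weight_lt` is the descent.

Complexity: in each extension graph the edges plus one equal the left vertices plus the right
vertices. Summed over the words of a given length, this says that the second difference of the
complexity vanishes; the initial values are 1 and 3.

Frequencies: Cassaigne's algorithm subtracts the smaller of the outer entries from the larger and
permutes. Rational independence rules out ties, so all iterates stay positive and a directive
sequence is read off. The main point is `exists_eq_smul_of_orbit_nonneg`: the vectors whose iterates
along that sequence all stay nonnegative are multiples of `x`. By compactness, normalized letter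
counts of deep blocks are uniformly close to `x`, which yields both primitivity and frequencies. -/

namespace SAdic

/-! ### Factor-closed and biextendable languages -/

/-- The language of the factors of the images under `σ` of the words of `X`. -/
def imageLanguage {A : Type*} (σ : Substitution A) (X : Set (List A)) : Set (List A) :=
  {u | ∃ y ∈ X, u <:+: y.flatMap σ}

/-- The set of words `X` contains the factors of its elements. -/
def FactorClosed {A : Type*} (X : Set (List A)) : Prop :=
  ∀ u v, u <:+: v → v ∈ X → u ∈ X

/-- Every word of `X` extends on both sides within `X`. -/
def Biextendable {A : Type*} (X : Set (List A)) : Prop :=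
  ∀ u ∈ X, ∃ a b, a :: (u ++ [b]) ∈ X

theorem FactorClosed.append_left {A : Type*} {X : Set (List A)} (hX : FactorClosed X)
    {u v : List A} (h : u ++ v ∈ X) : u ∈ X :=
  hX _ _ (List.prefix_append u v).isInfix h

theorem FactorClosed.append_right {A : Type*} {X : Set (List A)} (hX : FactorClosed X)
    {u v : List A} (h : u ++ v ∈ X) : v ∈ X :=
  hX _ _ (List.suffix_append u v).isInfix h

theorem Biextendable.exists_append {A : Type*} {X : Set (List A)} (hb : Biextendable X)
    (hX : FactorClosed X) {u : List A} (h : u ∈ X) : ∃ b, u ++ [b] ∈ X := by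
  obtain ⟨a, b, hab⟩ := hb u h
  exact ⟨b, hX.append_right (u := [a]) hab⟩

/-! ### Cutting words into blocks of `c₁` -/

@[simp] theorem c₁_zero : c₁ 0 = [0] := rfl
@[simp] theorem c₁_one : c₁ 1 = [0, 2] := rfl
@[simp] theorem c₁_two : c₁ 2 = [1] := rfl
@[simp] theorem c₂_zero : c₂ 0 = [1] := rfl
@[simp] theorem c₂_one : c₂ 1 = [0, 2] := rfl
@[simp] theorem c₂_two : c₂ 2 = [2] := rfl

/-- The letter whose image under `c₁` ends with the given letter. -/
def lastPreimage : Fin 3 → Fin 3 := ![0, 2, 1]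

@[simp] theorem lastPreimage_zero : lastPreimage 0 = 0 := rfl
@[simp] theorem lastPreimage_one : lastPreimage 1 = 2 := rfl
@[simp] theorem lastPreimage_two : lastPreimage 2 = 1 := rfl

theorem lastPreimage_lastPreimage (a : Fin 3) : lastPreimage (lastPreimage a) = a := by
  fin_cases a <;> rfl

theorem letter_cases (b : Fin 3) : b = 0 ∨ b = 1 ∨ b = 2 := by
  fin_cases b <;> simp

theorem head_flatMap_c₁ (y : List (Fin 3)) : (y.flatMap c₁).head? ≠ some 2 := by
  rcases y with _ | ⟨b, y⟩
  · simp
  · rcases letter_cases b with rfl | rfl | rfl <;> simp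

theorem head_flatMap_c₁_append (y : List (Fin 3)) {z : List (Fin 3)} (hz : z.head? ≠ some 2) :
    (y.flatMap c₁ ++ z).head? ≠ some 2 := by
  rcases y with _ | ⟨b, y⟩
  · simpa using hz
  · rcases letter_cases b with rfl | rfl | rfl <;> simp

/-- The letter 2 occurs only as the second letter of the block 02, so a cut in front of any other
letter falls between two blocks. -/
theorem flatMap_c₁_eq_append {y p z : List (Fin 3)} (h : y.flatMap c₁ = p ++ z)
    (hz : z.head? ≠ some 2) :
    ∃ y₁ y₂, y = y₁ ++ y₂ ∧ y₁.flatMap c₁ = p ∧ y₂.flatMap c₁ = z := by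
  induction y generalizing p with
  | nil =>
    simp only [List.flatMap_nil, List.nil_eq, List.append_eq_nil_iff] at h
    exact ⟨[], [], by simp [h]⟩
  | cons b y ih =>
    rcases p with _ | ⟨d, p⟩
    · exact ⟨[], b :: y, rfl, rfl, h⟩
    · rcases letter_cases b with rfl | rfl | rfl
      · simp only [List.flatMap_cons, c₁_zero, List.cons_append, List.nil_append,
          List.cons.injEq] at h
        obtain ⟨y₁, y₂, rfl, h₁, h₂⟩ := ih h.2
        exact ⟨0 :: y₁, y₂, rfl, by simp [h₁, ← h.1], h₂⟩
      · simp only [List.flatMap_cons, c₁_one, List.cons_append, List.nil_append,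
          List.cons.injEq] at h
        rcases p with _ | ⟨e, p⟩
        · exact absurd (by rw [← List.nil_append z, ← h.2]; rfl) hz
        · simp only [List.cons_append, List.cons.injEq] at h
          obtain ⟨y₁, y₂, rfl, h₁, h₂⟩ := ih h.2.2
          exact ⟨1 :: y₁, y₂, rfl, by simp [h₁, ← h.1, ← h.2.1], h₂⟩
      · simp only [List.flatMap_cons, c₁_two, List.cons_append, List.nil_append,
          List.cons.injEq] at h
        obtain ⟨y₁, y₂, rfl, h₁, h₂⟩ := ih h.2
        exact ⟨2 :: y₁, y₂, rfl, by simp [h₁, ← h.1], h₂⟩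

/-- The only confusion is between the blocks 0 and 02, and the next letter decides; the condition on
`z` settles it for the last letter of `v`. -/
theorem flatMap_c₁_eq_flatMap_append {y v z : List (Fin 3)}
    (h : y.flatMap c₁ = v.flatMap c₁ ++ z) (hz : z.head? ≠ some 2) :
    ∃ y₁, y = v ++ y₁ ∧ y₁.flatMap c₁ = z := by
  induction v generalizing y with
  | nil => exact ⟨y, rfl, h⟩
  | cons b v ih =>
    have hh := head_flatMap_c₁ y
    have hv := head_flatMap_c₁_append v hz
    rcases y with _ | ⟨d, y⟩
    · rcases letter_cases b with rfl | rfl | rfl <;> simp at h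
    · have hy := head_flatMap_c₁ y
      have key : b = d ∧ y.flatMap c₁ = v.flatMap c₁ ++ z := by
        rcases letter_cases b with rfl | rfl | rfl <;>
        rcases letter_cases d with rfl | rfl | rfl <;>
        simp only [List.flatMap_cons, c₁_zero, c₁_one, c₁_two, List.cons_append,
          List.nil_append, List.cons.injEq, true_and] at h ⊢
        · exact h
        · rw [← h] at hv; simp at hv
        · simp at h
        · rw [h] at hy; simp at hy
        · exact h
        · simp at h
        · simp at h
        · simp at h
        · exact h
      obtain ⟨y₁, rfl, h₁⟩ := ih key.2
      exact ⟨y₁, by simp [key.1], h₁⟩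

theorem flatMap_c₁_eq_concat {y p : List (Fin 3)} {a : Fin 3} (h : y.flatMap c₁ = p ++ [a]) :
    ∃ y₁, y = y₁ ++ [lastPreimage a] := by
  rcases List.eq_nil_or_concat y with rfl | ⟨y₁, b, rfl⟩
  · simp at h
  · refine ⟨y₁, ?_⟩
    have h2 := congrArg List.getLast? h
    rcases letter_cases b with rfl | rfl | rfl <;> simp at h2 <;> simp [← h2]

/-- A prefix that stops inside a block 02 ends with 0, which is itself a block. -/
theorem exists_of_prefix_flatMap_c₁ {y u : List (Fin 3)} (h : u <+: y.flatMap c₁) :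
    ∃ v : List (Fin 3), u = v.flatMap c₁ := by
  induction y generalizing u with
  | nil => exact ⟨[], by simpa using h⟩
  | cons b y ih =>
    rcases u with _ | ⟨d, u⟩
    · exact ⟨[], rfl⟩
    · rcases letter_cases b with rfl | rfl | rfl
      · simp only [List.flatMap_cons, c₁_zero, List.cons_append, List.nil_append,
          List.cons_prefix_cons] at h
        obtain ⟨v, rfl⟩ := ih h.2
        exact ⟨0 :: v, by simp [h.1]⟩
      · simp only [List.flatMap_cons, c₁_one, List.cons_append, List.nil_append,
          List.cons_prefix_cons] at h
        rcases u with _ | ⟨e, u⟩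
        · exact ⟨[0], by simp [h.1]⟩
        · simp only [List.cons_prefix_cons] at h
          obtain ⟨v, rfl⟩ := ih h.2.2
          exact ⟨1 :: v, by simp [h.1, h.2.1]⟩
      · simp only [List.flatMap_cons, c₁_two, List.cons_append, List.nil_append,
          List.cons_prefix_cons] at h
        obtain ⟨v, rfl⟩ := ih h.2
        exact ⟨2 :: v, by simp [h.1]⟩

theorem exists_of_mem_imageLanguage_c₁ {X : Set (List (Fin 3))} {u : List (Fin 3)}
    (h : u ∈ imageLanguage c₁ X) (hu : u.head? ≠ some 2) : ∃ v : List (Fin 3), u = v.flatMap c₁ := by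
  obtain ⟨y, -, p, q, hpq⟩ := h
  rcases u with _ | ⟨d, u⟩
  · exact ⟨[], rfl⟩
  · rw [List.append_assoc] at hpq
    obtain ⟨y₁, y₂, -, -, h₂⟩ := flatMap_c₁_eq_append hpq.symm (by simpa using hu)
    exact exists_of_prefix_flatMap_c₁ (y := y₂) ⟨q, h₂.symm⟩

theorem eq_zero_of_infix_flatMap_c₁ {y : List (Fin 3)} {a : Fin 3}
    (h : [a, 2] <:+: y.flatMap c₁) : a = 0 := by
  induction y with
  | nil => simp at h
  | cons b y ih =>
    have hy := head_flatMap_c₁ y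
    rcases letter_cases b with rfl | rfl | rfl <;>
    simp only [List.flatMap_cons, c₁_zero, c₁_one, c₁_two, List.cons_append, List.nil_append,
      List.infix_cons_iff, List.cons_prefix_cons] at h
    · rcases h with h | h
      · exact h.1
      · exact ih h
    · rcases h with h | h | h
      · exact h.1
      · obtain ⟨-, t, ht⟩ := h
        rw [← ht] at hy
        simp at hy
      · exact ih h
    · rcases h with h | h
      · obtain ⟨-, t, ht⟩ := h
        rw [← ht] at hy
        simp at hy
      · exact ih h

theorem eq_zero_of_mem_imageLanguage_c₁ {X : Set (List (Fin 3))} {x z : List (Fin 3)} {a : Fin 3}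
    (h : x ++ a :: 2 :: z ∈ imageLanguage c₁ X) : a = 0 := by
  obtain ⟨y, -, hy⟩ := h
  exact eq_zero_of_infix_flatMap_c₁ (List.IsInfix.trans ⟨x, z, by simp⟩ hy)

theorem factorClosed_imageLanguage {A : Type*} (σ : Substitution A) (X : Set (List A)) :
    FactorClosed (imageLanguage σ X) := by
  rintro u v huv ⟨y, hy, h⟩
  exact ⟨y, hy, huv.trans h⟩

/-- The two cuts around `v.flatMap c₁` fall between blocks. The block on the left is known from its
last letter alone, whereas on the right `t` determines the preimage only partially. -/
theorem cons_flatMap_c₁_append_mem {X : Set (List (Fin 3))} (hX : FactorClosed X)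
    {a : Fin 3} {v t : List (Fin 3)} (ht : t ≠ []) (ht2 : t.head? ≠ some 2) :
    a :: (v.flatMap c₁ ++ t) ∈ imageLanguage c₁ X ↔
      ∃ y, lastPreimage a :: (v ++ y) ∈ X ∧ t <+: y.flatMap c₁ := by
  constructor
  · rintro ⟨y, hy, p, q, hpq⟩
    have hq : (t ++ q).head? ≠ some 2 := by
      rcases t with _ | ⟨d, t⟩
      · exact absurd rfl ht
      · simpa using ht2
    have e : y.flatMap c₁ = (p ++ [a]) ++ (v.flatMap c₁ ++ (t ++ q)) := by
      rw [← hpq]; simp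
    obtain ⟨y₁, y₂, rfl, h₁, h₂⟩ := flatMap_c₁_eq_append e (head_flatMap_c₁_append v hq)
    obtain ⟨y₃, rfl, h₃⟩ := flatMap_c₁_eq_flatMap_append h₂ hq
    obtain ⟨y₀, rfl⟩ := flatMap_c₁_eq_concat h₁
    refine ⟨y₃, hX _ _ ⟨y₀, [], ?_⟩ hy, q, h₃.symm⟩
    simp
  · rintro ⟨y, hy, hty⟩
    refine ⟨_, hy, ?_⟩
    obtain ⟨q, hq⟩ := hty
    rcases letter_cases a with rfl | rfl | rfl
    · exact ⟨[], q, by simp [← hq]⟩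
    · exact ⟨[], q, by simp [← hq]⟩
    -- The block ending with 2 is 02, so an extra 0 stands in front.
    · exact ⟨[0], q, by simp [← hq]⟩

/-! ### Extensions of images under `c₁` -/

variable {X Y : Set (List (Fin 3))}

theorem extension_zero_c₁ (hX : FactorClosed X) {a : Fin 3} {v : List (Fin 3)} :
    a :: (v.flatMap c₁ ++ [0]) ∈ imageLanguage c₁ X ↔
      lastPreimage a :: (v ++ [0]) ∈ X ∨ lastPreimage a :: (v ++ [1]) ∈ X := by
  rw [cons_flatMap_c₁_append_mem hX (by simp) (by simp)]
  constructor
  · rintro ⟨y, hy, h⟩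
    rcases y with _ | ⟨b, y⟩
    · simp at h
    · have := hX.append_left (u := lastPreimage a :: (v ++ [b])) (v := y) (by simpa using hy)
      rcases letter_cases b with rfl | rfl | rfl
      · exact Or.inl this
      · exact Or.inr this
      · simp at h
  · rintro (h | h)
    · exact ⟨_, h, by simp⟩
    · exact ⟨_, h, by simp⟩

theorem extension_one_c₁ (hX : FactorClosed X) {a : Fin 3} {v : List (Fin 3)} :
    a :: (v.flatMap c₁ ++ [1]) ∈ imageLanguage c₁ X ↔ lastPreimage a :: (v ++ [2]) ∈ X := by
  rw [cons_flatMap_c₁_append_mem hX (by simp) (by simp)]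
  constructor
  · rintro ⟨y, hy, h⟩
    rcases y with _ | ⟨b, y⟩
    · simp at h
    · have := hX.append_left (u := lastPreimage a :: (v ++ [b])) (v := y) (by simpa using hy)
      rcases letter_cases b with rfl | rfl | rfl
      · simp at h
      · simp at h
      · exact this
  · intro h
    exact ⟨_, h, by simp⟩

theorem extension_zero_two_c₁ (hX : FactorClosed X) {a : Fin 3} {v : List (Fin 3)} :
    a :: (v.flatMap c₁ ++ [0, 2]) ∈ imageLanguage c₁ X ↔ lastPreimage a :: (v ++ [1]) ∈ X := by
  rw [cons_flatMap_c₁_append_mem hX (by simp) (by simp)]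
  constructor
  · rintro ⟨y, hy, h⟩
    rcases y with _ | ⟨b, y⟩
    · simp at h
    · have := hX.append_left (u := lastPreimage a :: (v ++ [b])) (v := y) (by simpa using hy)
      rcases letter_cases b with rfl | rfl | rfl
      · simp only [List.flatMap_cons, c₁_zero, List.cons_append, List.nil_append,
          List.cons_prefix_cons] at h
        obtain ⟨-, t, ht⟩ := h
        exact absurd (by rw [← ht]; rfl) (head_flatMap_c₁ y)
      · exact this
      · simp at h
  · intro h
    exact ⟨_, h, by simp⟩

theorem extension_zero_one_c₁ (hX : FactorClosed X) {a : Fin 3} {v : List (Fin 3)} :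
    a :: (v.flatMap c₁ ++ [0, 1]) ∈ imageLanguage c₁ X ↔
      lastPreimage a :: (v ++ [0, 2]) ∈ X := by
  rw [cons_flatMap_c₁_append_mem hX (by simp) (by simp)]
  constructor
  · rintro ⟨y, hy, h⟩
    rcases y with _ | ⟨b, _ | ⟨d, y⟩⟩
    · simp at h
    · rcases letter_cases b with rfl | rfl | rfl <;> simp at h
    · have := hX.append_left (u := lastPreimage a :: (v ++ [b, d])) (v := y) (by simpa using hy)
      rcases letter_cases b with rfl | rfl | rfl <;>
      rcases letter_cases d with rfl | rfl | rfl <;> simp at h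
      exact this
  · intro h
    exact ⟨_, h, by simp⟩

theorem extension_zero_zero_c₁ (hX : FactorClosed X) {a : Fin 3} {v : List (Fin 3)} :
    a :: (v.flatMap c₁ ++ [0, 0]) ∈ imageLanguage c₁ X ↔
      lastPreimage a :: (v ++ [0, 0]) ∈ X ∨ lastPreimage a :: (v ++ [0, 1]) ∈ X := by
  rw [cons_flatMap_c₁_append_mem hX (by simp) (by simp)]
  constructor
  · rintro ⟨y, hy, h⟩
    rcases y with _ | ⟨b, _ | ⟨d, y⟩⟩
    · simp at h
    · rcases letter_cases b with rfl | rfl | rfl <;> simp at h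
    · have := hX.append_left (u := lastPreimage a :: (v ++ [b, d])) (v := y) (by simpa using hy)
      rcases letter_cases b with rfl | rfl | rfl <;>
      rcases letter_cases d with rfl | rfl | rfl <;> simp at h
      · exact Or.inl this
      · exact Or.inr this
  · rintro (h | h)
    · exact ⟨_, h, by simp⟩
    · exact ⟨_, h, by simp⟩

/-- The square of `c₁` is 0 ↦ 0, 1 ↦ 01, 2 ↦ 02: each image ends with its letter and starts with 0.
Biextendability matters for `b = 0`, where the second 0 must be followed by another block to be seen
after the added 0. -/
theorem extension_c₁_c₁ (hY : FactorClosed Y) (hb : Biextendable Y) {a b : Fin 3}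
    {v : List (Fin 3)} :
    a :: (((v.flatMap c₁).flatMap c₁ ++ [0]) ++ [b]) ∈ imageLanguage c₁ (imageLanguage c₁ Y) ↔
      a :: (v ++ [b]) ∈ Y := by
  have hX := factorClosed_imageLanguage c₁ Y
  rw [List.append_assoc, List.singleton_append]
  rcases letter_cases b with rfl | rfl | rfl
  · rw [extension_zero_zero_c₁ hX, extension_zero_zero_c₁ hY, extension_zero_one_c₁ hY,
      lastPreimage_lastPreimage]
    constructor
    · rintro ((h | h) | h) <;>
        exact hY.append_left (u := a :: (v ++ [0])) (v := [_]) (by simpa using h)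
    · intro h
      obtain ⟨d, hd⟩ := hb.exists_append hY h
      simp only [List.cons_append, List.append_assoc, List.nil_append] at hd
      rcases letter_cases d with rfl | rfl | rfl <;> tauto
  · rw [extension_zero_one_c₁ hX, extension_zero_two_c₁ hY, lastPreimage_lastPreimage]
  · rw [extension_zero_two_c₁ hX, extension_one_c₁ hY, lastPreimage_lastPreimage]

/-! ### Good trees on two copies of three letters, checked over all 512 matrices -/

/-- A nonempty bipartite graph on two copies of the alphabet (given by its adjacency matrix, isolated
vertices being ignored) that is a tree, and in which the columns `0, 1`, and likewise the rows
`1, 2`, have a common neighbour as soon as both are present. -/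
def IsGoodTree (e : Fin 3 → Fin 3 → Bool) : Bool :=
  let row a := e a 0 || e a 1 || e a 2
  let col b := e 0 b || e 1 b || e 2 b
  let cols a₀ b c := (e a₀ b && e a₀ c)
  let common b c := cols 0 b c || cols 1 b c || cols 2 b c
  let linked b c d := !col b || !col c || common b c || (common b d && common d c)
  (row 0 || row 1 || row 2) &&
  ((e 0 0).toNat + (e 0 1).toNat + (e 0 2).toNat + (e 1 0).toNat + (e 1 1).toNat + (e 1 2).toNat +
    (e 2 0).toNat + (e 2 1).toNat + (e 2 2).toNat + 1 ==
    (row 0).toNat + (row 1).toNat + (row 2).toNat + (col 0).toNat + (col 1).toNat +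
      (col 2).toNat) &&
  linked 0 1 2 && linked 0 2 1 && linked 1 2 0 &&
  (!col 0 || !col 1 || common 0 1) &&
  (!row 1 || !row 2 || (e 1 0 && e 2 0) || (e 1 1 && e 2 1) || (e 1 2 && e 2 2))

/-- The matrix with the given entries. -/
def ofEntries (p q r s t u v w x : Bool) : Fin 3 → Fin 3 → Bool :=
  ![![p, q, r], ![s, t, u], ![v, w, x]]

theorem forall_of_ofEntries {P : (Fin 3 → Fin 3 → Bool) → Prop}
    (h : ∀ p q r s t u v w x, P (ofEntries p q r s t u v w x)) (e : Fin 3 → Fin 3 → Bool) :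
    P e := by
  have : e = ofEntries (e 0 0) (e 0 1) (e 0 2) (e 1 0) (e 1 1) (e 1 2) (e 2 0) (e 2 1) (e 2 2) := by
    funext a b
    fin_cases a <;> fin_cases b <;> rfl
  rw [this]
  exact h ..

/-- Transpose of a matrix along the antidiagonal. -/
def mirrorMatrix (e : Fin 3 → Fin 3 → Bool) : Fin 3 → Fin 3 → Bool :=
  fun a b => e b.rev a.rev

/-- The matrix of extensions of `c₁(v)` in terms of that of `v`. -/
def mergeMatrix (e : Fin 3 → Fin 3 → Bool) : Fin 3 → Fin 3 → Bool :=
  fun a => ![e (lastPreimage a) 0 || e (lastPreimage a) 1, e (lastPreimage a) 2, false]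

/-- The matrix of extensions of `c₁(v)1` in terms of that of `v`. -/
def shiftMatrix (e : Fin 3 → Fin 3 → Bool) : Fin 3 → Fin 3 → Bool :=
  fun a => ![false, e (lastPreimage a) 0, e (lastPreimage a) 1]

/-- The matrix of extensions of the empty word after `c₁`. -/
def emptyMatrix (e : Fin 3 → Fin 3 → Bool) : Fin 3 → Fin 3 → Bool :=
  fun a => ![e (lastPreimage a) 0 || e (lastPreimage a) 1, e (lastPreimage a) 2,
    ![true, false, false] a]

/-- No row and no column vanishes. -/
def IsFull (e : Fin 3 → Fin 3 → Bool) : Bool :=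
  (e 0 0 || e 0 1 || e 0 2) && (e 1 0 || e 1 1 || e 1 2) && (e 2 0 || e 2 1 || e 2 2) &&
  (e 0 0 || e 1 0 || e 2 0) && (e 0 1 || e 1 1 || e 2 1) && (e 0 2 || e 1 2 || e 2 2)

/-- The antidiagonal transpose exchanges the condition on columns 0, 1 with the one on rows 1, 2. -/
theorem IsGoodTree.mirror (e : Fin 3 → Fin 3 → Bool) :
    IsGoodTree e → IsGoodTree (mirrorMatrix e) := by
  revert e
  exact forall_of_ofEntries (by decide +kernel)

/-- When columns 0 and 1 are both present, they have exactly one common neighbour in a tree, so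
identifying them loses one vertex and one edge. The row permutation `lastPreimage` swaps rows 1 and
2, which the invariant allows. -/
theorem IsGoodTree.merge (e : Fin 3 → Fin 3 → Bool) :
    IsGoodTree e → IsGoodTree (mergeMatrix e) := by
  revert e
  exact forall_of_ofEntries (by decide +kernel)

/-- Removing column 2 does not disconnect the rest, because columns 0 and 1 share a neighbour
whenever both are present; rows seen only by column 2 disappear with it. -/
theorem IsGoodTree.shift (e : Fin 3 → Fin 3 → Bool) :
    IsGoodTree e → (∃ a b, shiftMatrix e a b) → IsGoodTree (shiftMatrix e) := by
  revert e
  exact forall_of_ofEntries (by decide +kernel)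

theorem isGoodTree_of_unique_row (e : Fin 3 → Fin 3 → Bool) :
    (∃ a b, e a b) → (∃ a, ∀ a' b, e a' b → a' = a) → IsGoodTree e := by
  revert e
  exact forall_of_ofEntries (by decide +kernel)

theorem isGoodTree_of_unique_col (e : Fin 3 → Fin 3 → Bool) :
    (∃ a b, e a b) → (∃ b, ∀ a b', e a b' → b' = b) → IsGoodTree e := by
  revert e
  exact forall_of_ofEntries (by decide +kernel)

/-- The four conjuncts are the possible continuations of a rank with `c₁` by two more substitutions,
`c₂` being `c₁` conjugated by the mirror; in the last one two mirrors have cancelled. Three ranks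
suffice whatever the full matrix above them. -/
theorem isGoodTree_emptyMatrix (e : Fin 3 → Fin 3 → Bool) :
    IsFull e →
      IsGoodTree (emptyMatrix (emptyMatrix (emptyMatrix e))) ∧
      IsGoodTree (emptyMatrix (emptyMatrix (mirrorMatrix (emptyMatrix (mirrorMatrix e))))) ∧
      IsGoodTree (emptyMatrix (mirrorMatrix (emptyMatrix (mirrorMatrix (emptyMatrix e))))) ∧
      IsGoodTree (emptyMatrix (mirrorMatrix (emptyMatrix (emptyMatrix (mirrorMatrix e))))) := by
  revert e
  exact forall_of_ofEntries (by decide +kernel)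

theorem IsGoodTree.exists_path (e : Fin 3 → Fin 3 → Bool) :
    IsGoodTree e → ∀ a b a' b', e a b → e a' b' →
      ∃ a₁ b₁ a₂, e a₁ b ∧ e a₁ b₁ ∧ e a₂ b₁ ∧ e a₂ b' := by
  revert e
  exact forall_of_ofEntries (by decide +kernel)

theorem IsGoodTree.card_eq (e : Fin 3 → Fin 3 → Bool) :
    IsGoodTree e → Fintype.card {p : Fin 3 × Fin 3 // e p.1 p.2} + 1 =
      Fintype.card {a // ∃ b, e a b} + Fintype.card {b // ∃ a, e a b} := by
  revert e
  exact forall_of_ofEntries (by decide +kernel)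

theorem IsGoodTree.nonempty (e : Fin 3 → Fin 3 → Bool) :
    IsGoodTree e → ∃ a b, e a b := by
  revert e
  exact forall_of_ofEntries (by decide +kernel)

/-! ### The mirror symmetry between `c₁` and `c₂` -/

/-- The mirror image of a word: reversal combined with the exchange of the letters `1` and `3`. -/
def mirrorWord (u : List (Fin 3)) : List (Fin 3) := (u.map Fin.rev).reverse

/-- The substitution conjugate to `σ` under the mirror image. -/
def mirrorSubstitution (σ : Substitution (Fin 3)) : Substitution (Fin 3) :=
  fun a => mirrorWord (σ a.rev)

/-- The set of mirror images of the words of `X`. -/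
def mirrorLanguage (X : Set (List (Fin 3))) : Set (List (Fin 3)) := {u | mirrorWord u ∈ X}

@[simp] theorem mirrorWord_mirrorWord (u : List (Fin 3)) : mirrorWord (mirrorWord u) = u := by
  simp [mirrorWord, List.map_reverse, Function.comp_def]

@[simp] theorem mirrorWord_nil : mirrorWord [] = [] := rfl

theorem mirrorWord_append (u v : List (Fin 3)) :
    mirrorWord (u ++ v) = mirrorWord v ++ mirrorWord u := by
  simp [mirrorWord]

theorem mirrorWord_cons (a : Fin 3) (v : List (Fin 3)) :
    mirrorWord (a :: v) = mirrorWord v ++ [a.rev] := by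
  simp [mirrorWord]

theorem mirrorWord_flatMap (u : List (Fin 3)) (σ : Substitution (Fin 3)) :
    mirrorWord (u.flatMap σ) = (mirrorWord u).flatMap (mirrorSubstitution σ) := by
  induction u with
  | nil => rfl
  | cons a u ih =>
    simp [mirrorWord_append, mirrorWord_cons, ih, mirrorSubstitution]

theorem mirrorWord_infix {u v : List (Fin 3)} (h : u <:+: v) : mirrorWord u <:+: mirrorWord v := by
  obtain ⟨p, q, rfl⟩ := h
  exact ⟨mirrorWord q, mirrorWord p, by simp [mirrorWord_append]⟩

theorem mirrorSubstitution_c₁ : mirrorSubstitution c₁ = c₂ := by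
  funext a; fin_cases a <;> rfl

theorem mirrorSubstitution_c₂ : mirrorSubstitution c₂ = c₁ := by
  funext a; fin_cases a <;> rfl

theorem mirrorLanguage_mirrorLanguage (X : Set (List (Fin 3))) :
    mirrorLanguage (mirrorLanguage X) = X := by
  ext u; simp [mirrorLanguage]

theorem mirrorLanguage_imageLanguage (σ : Substitution (Fin 3)) (X : Set (List (Fin 3))) :
    mirrorLanguage (imageLanguage σ X) =
      imageLanguage (mirrorSubstitution σ) (mirrorLanguage X) := by
  ext u
  constructor
  · rintro ⟨y, hy, h⟩
    refine ⟨mirrorWord y, by simpa [mirrorLanguage] using hy, ?_⟩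
    rw [← mirrorWord_flatMap, ← mirrorWord_mirrorWord u]
    exact mirrorWord_infix h
  · rintro ⟨y, hy, h⟩
    refine ⟨mirrorWord y, hy, ?_⟩
    have := mirrorWord_infix h
    rwa [← mirrorWord_mirrorWord y, ← mirrorWord_flatMap, mirrorWord_mirrorWord] at this

theorem FactorClosed.mirror {X : Set (List (Fin 3))} (hX : FactorClosed X) :
    FactorClosed (mirrorLanguage X) :=
  fun _ _ huv hv => hX _ _ (mirrorWord_infix huv) hv

theorem Biextendable.mirror {X : Set (List (Fin 3))} (hX : Biextendable X) :
    Biextendable (mirrorLanguage X) := by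
  intro u hu
  obtain ⟨a, b, h⟩ := hX _ hu
  refine ⟨b.rev, a.rev, ?_⟩
  simpa [mirrorLanguage, mirrorWord_cons, mirrorWord_append] using h

/-! ### Extension matrices of languages -/

open Classical in
/-- The adjacency matrix of the extension graph of `u` in the language `X`. -/
noncomputable def extensionMatrix (X : Set (List (Fin 3))) (u : List (Fin 3)) :
    Fin 3 → Fin 3 → Bool :=
  fun a b => decide (a :: (u ++ [b]) ∈ X)

@[simp] theorem extensionMatrix_eq_true {X : Set (List (Fin 3))} {u : List (Fin 3)}
    {a b : Fin 3} : extensionMatrix X u a b = true ↔ a :: (u ++ [b]) ∈ X := by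
  simp [extensionMatrix]

theorem matrix_ext {e e' : Fin 3 → Fin 3 → Bool} (h : ∀ a b, e a b = true ↔ e' a b = true) :
    e = e' := by
  funext a b
  exact Bool.eq_iff_iff.2 (h a b)

theorem extensionMatrix_mirrorLanguage (X : Set (List (Fin 3))) (u : List (Fin 3)) :
    extensionMatrix (mirrorLanguage X) u = mirrorMatrix (extensionMatrix X (mirrorWord u)) := by
  apply matrix_ext
  intro a b
  simp [mirrorMatrix, mirrorLanguage, mirrorWord_cons, mirrorWord_append]

theorem mirrorMatrix_mirrorMatrix (e : Fin 3 → Fin 3 → Bool) :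
    mirrorMatrix (mirrorMatrix e) = e := by
  funext a b; simp [mirrorMatrix]

theorem extensionMatrix_c₁_nil {X : Set (List (Fin 3))} (hX : FactorClosed X) (h1 : [1] ∈ X) :
    extensionMatrix (imageLanguage c₁ X) [] = emptyMatrix (extensionMatrix X []) := by
  apply matrix_ext
  intro a b
  have h₀ := extension_zero_c₁ (v := []) (a := a) hX
  have h₁ := extension_one_c₁ (v := []) (a := a) hX
  simp only [List.flatMap_nil, List.nil_append] at h₀ h₁
  rcases letter_cases b with rfl | rfl | rfl
  · simp [emptyMatrix, h₀]
  · simp [emptyMatrix, h₁]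
  · simp only [extensionMatrix_eq_true, List.nil_append, emptyMatrix]
    constructor
    · intro h
      rw [eq_zero_of_mem_imageLanguage_c₁ (x := []) h]
      rfl
    · intro h
      rcases letter_cases a with rfl | rfl | rfl <;> simp at h
      exact ⟨[1], h1, by simp⟩

theorem extensionMatrix_c₂_nil {X : Set (List (Fin 3))} (hX : FactorClosed X) (h1 : [1] ∈ X) :
    extensionMatrix (imageLanguage c₂ X) [] =
      mirrorMatrix (emptyMatrix (mirrorMatrix (extensionMatrix X []))) := by
  have : imageLanguage c₂ X = mirrorLanguage (imageLanguage c₁ (mirrorLanguage X)) := by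
    rw [mirrorLanguage_imageLanguage, mirrorLanguage_mirrorLanguage, mirrorSubstitution_c₁]
  rw [this, extensionMatrix_mirrorLanguage, mirrorWord_nil, extensionMatrix_c₁_nil hX.mirror h1,
    extensionMatrix_mirrorLanguage, mirrorWord_nil]

theorem eq_two_of_mem_imageLanguage_c₂ {X : Set (List (Fin 3))} {x z : List (Fin 3)} {d : Fin 3}
    (h : x ++ 0 :: d :: z ∈ imageLanguage c₂ X) : d = 2 := by
  rw [← mirrorSubstitution_c₁, ← mirrorLanguage_mirrorLanguage X,
    ← mirrorLanguage_imageLanguage] at h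
  have h' : mirrorWord z ++ d.rev :: 2 :: mirrorWord x ∈ imageLanguage c₁ (mirrorLanguage X) := by
    simpa [mirrorLanguage, mirrorWord_cons, mirrorWord_append] using h
  have := eq_zero_of_mem_imageLanguage_c₁ h'
  rcases letter_cases d with rfl | rfl | rfl <;> simp_all

/-! ### Chains of languages and the empty word -/

/-- A sequence of languages, each of which is generated from the next one by a substitution of
`𝒞`. -/
structure IsChain (s : ℕ → Substitution (Fin 3)) (L : ℕ → Set (List (Fin 3))) : Prop where
  mem : ∀ n, s n ∈ cassaigneSet
  eq_image : ∀ n, L n = imageLanguage (s n) (L (n + 1))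
  biextendable : ∀ n, Biextendable (L n)
  letter_mem : ∀ n a, [a] ∈ L n

namespace IsChain

variable {s : ℕ → Substitution (Fin 3)} {L : ℕ → Set (List (Fin 3))}

theorem factorClosed (h : IsChain s L) (n : ℕ) : FactorClosed (L n) := by
  rw [h.eq_image]
  exact factorClosed_imageLanguage _ _

theorem eq_c₁_or_eq_c₂ (h : IsChain s L) (n : ℕ) : s n = c₁ ∨ s n = c₂ := h.mem n

theorem mirror (h : IsChain s L) :
    IsChain (fun n => mirrorSubstitution (s n)) (fun n => mirrorLanguage (L n)) where
  mem n := by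
    rcases h.eq_c₁_or_eq_c₂ n with e | e
    · rw [e, mirrorSubstitution_c₁]; exact Or.inr rfl
    · rw [e, mirrorSubstitution_c₂]; exact Or.inl rfl
  eq_image n := by rw [← mirrorLanguage_imageLanguage, ← h.eq_image]
  biextendable n := (h.biextendable n).mirror
  letter_mem n a := h.letter_mem n a.rev

theorem exists_extensionMatrix (h : IsChain s L) {n : ℕ} {u : List (Fin 3)} (hu : u ∈ L n) :
    ∃ a b, extensionMatrix (L n) u a b = true := by
  obtain ⟨a, b, hab⟩ := h.biextendable n u hu
  exact ⟨a, b, by simpa using hab⟩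

theorem mem_of_extensionMatrix (h : IsChain s L) {n : ℕ} {u : List (Fin 3)} {a b : Fin 3}
    (hu : extensionMatrix (L n) u a b = true) : u ∈ L n := by
  rw [extensionMatrix_eq_true] at hu
  exact (h.factorClosed n).append_left ((h.factorClosed n).append_right (u := [a]) hu)

theorem isFull (h : IsChain s L) (n : ℕ) : IsFull (extensionMatrix (L n) []) = true := by
  have hr : ∀ a, ∃ b, extensionMatrix (L n) [] a b = true := by
    intro a
    obtain ⟨b, hb⟩ := (h.biextendable n).exists_append (h.factorClosed n) (h.letter_mem n a)
    exact ⟨b, by simpa using hb⟩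
  have hc : ∀ b, ∃ a, extensionMatrix (L n) [] a b = true := by
    intro b
    obtain ⟨a, d, hd⟩ := h.biextendable n _ (h.letter_mem n b)
    exact ⟨a, by
      simpa using (h.factorClosed n).append_left (u := [a, b]) (v := [d]) (by simpa using hd)⟩
  have key : ∀ e : Fin 3 → Fin 3 → Bool, (∀ a, ∃ b, e a b = true) → (∀ b, ∃ a, e a b = true) →
      IsFull e = true := by
    intro e h₁ h₂
    have r₀ := h₁ 0
    have r₁ := h₁ 1
    have r₂ := h₁ 2
    have k₀ := h₂ 0
    have k₁ := h₂ 1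
    have k₂ := h₂ 2
    simp only [Fin.exists_fin_succ, Fin.succ_zero_eq_one, Fin.succ_one_eq_two,
      IsEmpty.exists_iff, or_false] at r₀ r₁ r₂ k₀ k₁ k₂
    simp only [IsFull, Bool.and_eq_true, Bool.or_eq_true, or_assoc]
    exact ⟨⟨⟨⟨⟨r₀, r₁⟩, r₂⟩, k₀⟩, k₁⟩, k₂⟩
  exact key _ hr hc

theorem isGoodTree_nil_of_c₁ (h : IsChain s L) {n : ℕ} (hn : s n = c₁) :
    IsGoodTree (extensionMatrix (L n) []) = true := by
  have e₁ : ∀ m, s m = c₁ →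
      extensionMatrix (L m) [] = emptyMatrix (extensionMatrix (L (m + 1)) []) := by
    intro m hm
    rw [h.eq_image m, hm, extensionMatrix_c₁_nil (h.factorClosed _) (h.letter_mem _ _)]
  have e₂ : ∀ m, s m = c₂ → extensionMatrix (L m) [] =
      mirrorMatrix (emptyMatrix (mirrorMatrix (extensionMatrix (L (m + 1)) []))) := by
    intro m hm
    rw [h.eq_image m, hm, extensionMatrix_c₂_nil (h.factorClosed _) (h.letter_mem _ _)]
  have key := isGoodTree_emptyMatrix _ (h.isFull (n + 1 + 1 + 1))
  rw [e₁ n hn]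
  rcases h.eq_c₁_or_eq_c₂ (n + 1) with h₁ | h₁ <;>
  rcases h.eq_c₁_or_eq_c₂ (n + 1 + 1) with h₂ | h₂
  · rw [e₁ _ h₁, e₁ _ h₂]; exact key.1
  · rw [e₁ _ h₁, e₂ _ h₂]; exact key.2.1
  · rw [e₂ _ h₁, e₁ _ h₂]; exact key.2.2.1
  · rw [e₂ _ h₁, e₂ _ h₂, mirrorMatrix_mirrorMatrix]; exact key.2.2.2

end IsChain

/-! ### Descent on bispecial words -/

/-- Letter weights for which desubstitution of bispecial words is strictly decreasing. -/
def letterWeight (σ : Substitution (Fin 3)) : Fin 3 → ℕ :=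
  if σ 0 = [0] then ![3, 4, 2] else ![2, 4, 3]

/-- The sum of the weights of the letters of a word. -/
def wordWeight (σ : Substitution (Fin 3)) (u : List (Fin 3)) : ℕ := (u.map (letterWeight σ)).sum

theorem letterWeight_c₁ : letterWeight c₁ = ![3, 4, 2] := rfl
theorem letterWeight_c₂ : letterWeight c₂ = ![2, 4, 3] := rfl

theorem wordWeight_append (σ : Substitution (Fin 3)) (u v : List (Fin 3)) :
    wordWeight σ (u ++ v) = wordWeight σ u + wordWeight σ v := by
  simp [wordWeight]

theorem wordWeight_c₁_mirrorWord (u : List (Fin 3)) :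
    wordWeight c₁ (mirrorWord u) = wordWeight c₂ u := by
  simp only [wordWeight, mirrorWord, List.map_reverse, List.sum_reverse, List.map_map]
  congr 2
  funext a
  fin_cases a <;> rfl

/-- Length does not decrease under desubstitution, since blocks may be single letters. These weights
make every block of `c₁` heavier by one than its preimage measured for `c₂`. -/
theorem wordWeight_flatMap_c₁ (v : List (Fin 3)) :
    wordWeight c₁ (v.flatMap c₁) = wordWeight c₂ v + v.length := by
  induction v with
  | nil => rfl
  | cons a v ih =>
    rw [List.flatMap_cons, wordWeight_append, ih, ← List.singleton_append, wordWeight_append]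
    rcases letter_cases a with rfl | rfl | rfl <;>
    simp [wordWeight, letterWeight_c₁, letterWeight_c₂] <;> omega

theorem wordWeight_c₁_le (v : List (Fin 3)) : wordWeight c₁ v ≤ wordWeight c₂ v + v.length := by
  induction v with
  | nil => rfl
  | cons a v ih =>
    rw [← List.singleton_append, wordWeight_append, wordWeight_append]
    rcases letter_cases a with rfl | rfl | rfl <;>
    simp [wordWeight, letterWeight_c₁, letterWeight_c₂] at ih ⊢ <;> omega

/-- Only a weak inequality, because of `c₁` followed by `c₁`; there the strict decrease comes from
the trailing 0 removed along the way. -/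
theorem wordWeight_le_flatMap_c₁ {σ : Substitution (Fin 3)} (hσ : σ = c₁ ∨ σ = c₂)
    (v : List (Fin 3)) : wordWeight σ v ≤ wordWeight c₁ (v.flatMap c₁) := by
  rw [wordWeight_flatMap_c₁]
  rcases hσ with rfl | rfl
  · exact wordWeight_c₁_le v
  · omega

theorem extensionMatrix_c₁_c₁ {Y : Set (List (Fin 3))} (hY : FactorClosed Y)
    (hb : Biextendable Y) (v : List (Fin 3)) :
    extensionMatrix (imageLanguage c₁ (imageLanguage c₁ Y)) ((v.flatMap c₁).flatMap c₁ ++ [0]) =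
      extensionMatrix Y v := by
  apply matrix_ext
  intro a b
  rw [extensionMatrix_eq_true, extensionMatrix_eq_true, extension_c₁_c₁ hY hb]

/-- In an image under `c₂` the letter 0 is always followed by 2, and 02 maps to 01. So 00 cannot
follow, 01 reveals that `v` was followed by 0, and 02 that it was followed by 1. -/
theorem extensionMatrix_concat_zero {Z : Set (List (Fin 3))}
    (hb : Biextendable (imageLanguage c₂ Z)) (v : List (Fin 3)) :
    extensionMatrix (imageLanguage c₁ (imageLanguage c₂ Z)) (v.flatMap c₁ ++ [0]) =
      shiftMatrix (extensionMatrix (imageLanguage c₂ Z) v) := by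
  have hX := factorClosed_imageLanguage c₂ Z
  apply matrix_ext
  intro a b
  rw [extensionMatrix_eq_true, List.append_assoc, List.singleton_append]
  rcases letter_cases b with rfl | rfl | rfl
  · rw [extension_zero_zero_c₁ hX]
    simp only [shiftMatrix, Matrix.cons_val_zero, Bool.false_eq_true, iff_false]
    rintro (h | h)
    · exact absurd (eq_two_of_mem_imageLanguage_c₂ (x := lastPreimage a :: v) h) (by decide)
    · exact absurd (eq_two_of_mem_imageLanguage_c₂ (x := lastPreimage a :: v) h) (by decide)
  · rw [extension_zero_one_c₁ hX]
    simp only [shiftMatrix, Matrix.cons_val_one, Matrix.cons_val_zero, extensionMatrix_eq_true]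
    constructor
    · intro h
      exact hX.append_left (u := lastPreimage a :: (v ++ [0])) (v := [2]) (by simpa using h)
    · intro h
      obtain ⟨d, hd⟩ := hb.exists_append hX h
      simp only [List.cons_append, List.append_assoc, List.nil_append] at hd
      rwa [eq_two_of_mem_imageLanguage_c₂ (x := lastPreimage a :: v) (d := d) (z := [])
        (by simpa using hd)] at hd
  · rw [extension_zero_two_c₁ hX]
    simp [shiftMatrix]

theorem not_mem_imageLanguage_of_ne {X : Set (List (Fin 3))} {v : List (Fin 3)} {a d : Fin 3}
    (hd : d ≠ 0) : a :: ((v ++ [d]) ++ [2]) ∉ imageLanguage c₁ X := by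
  intro h
  exact hd (eq_zero_of_mem_imageLanguage_c₁ (x := a :: v) (z := []) (by simpa using h))

theorem flatMap_c₁_concat {v : List (Fin 3)} {d : Fin 3} (hd : d ≠ 0) :
    ∃ v' d', d' ≠ 0 ∧ (v ++ [d]).flatMap c₁ = v' ++ [d'] := by
  rcases letter_cases d with rfl | rfl | rfl
  · exact absurd rfl hd
  · exact ⟨v.flatMap c₁ ++ [0], 2, by decide, by simp⟩
  · exact ⟨v.flatMap c₁, 1, by decide, by simp⟩

theorem extensionMatrix_concat_of_ne {X : Set (List (Fin 3))} (hX : FactorClosed X)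
    {v : List (Fin 3)} {d : Fin 3} (hd : d ≠ 0) :
    extensionMatrix (imageLanguage c₁ X) ((v ++ [d]).flatMap c₁) =
      mergeMatrix (extensionMatrix X (v ++ [d])) := by
  apply matrix_ext
  intro a b
  rw [extensionMatrix_eq_true]
  rcases letter_cases b with rfl | rfl | rfl
  · rw [extension_zero_c₁ hX]
    simp [mergeMatrix]
  · rw [extension_one_c₁ hX]
    simp [mergeMatrix]
  · obtain ⟨v', d', hd', e⟩ := flatMap_c₁_concat (v := v) hd
    rw [e]
    simp [mergeMatrix, -List.append_assoc, not_mem_imageLanguage_of_ne hd']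

namespace IsChain

/-- The induction runs over all chains at once, so that it applies at later ranks and survives
passing to the mirror chain. -/
theorem isGoodTree_of_weight_lt (N : ℕ) :
    ∀ (s : ℕ → Substitution (Fin 3)) (L : ℕ → Set (List (Fin 3))), IsChain s L → ∀ n, ∀ u ∈ L n,
      wordWeight (s n) u < N → IsGoodTree (extensionMatrix (L n) u) = true := by
  induction N with
  | zero => intro s L _ n u _ h; omega
  | succ N ih =>
    have key : ∀ (s : ℕ → Substitution (Fin 3)) (L : ℕ → Set (List (Fin 3))), IsChain s L →
        ∀ n, ∀ u ∈ L n, s n = c₁ → wordWeight (s n) u < N + 1 →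
        IsGoodTree (extensionMatrix (L n) u) = true := by
      intro s L h n u hu hn hw
      rcases eq_or_ne u [] with rfl | hne
      · exact h.isGoodTree_nil_of_c₁ hn
      obtain ⟨a₀, b₀, h₀⟩ := h.exists_extensionMatrix hu
      by_cases hr : ∃ a, ∀ a' b, extensionMatrix (L n) u a' b = true → a' = a
      · exact isGoodTree_of_unique_row _ ⟨a₀, b₀, h₀⟩ hr
      by_cases hc : ∃ b, ∀ a b', extensionMatrix (L n) u a b' = true → b' = b
      · exact isGoodTree_of_unique_col _ ⟨a₀, b₀, h₀⟩ hc
      have hX := h.factorClosed (n + 1)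
      have hL : L n = imageLanguage c₁ (L (n + 1)) := by rw [h.eq_image n, hn]
      -- The letter 2 is preceded only by 0, so a word starting with 2 would have a single row.
      have hhead : u.head? ≠ some 2 := by
        intro hh
        obtain ⟨u', rfl⟩ : ∃ u', u = 2 :: u' := by
          rcases u with _ | ⟨d, u'⟩
          · exact absurd rfl hne
          · exact ⟨u', by simpa using hh⟩
        refine hr ⟨0, fun a' b hab => ?_⟩
        rw [extensionMatrix_eq_true, hL] at hab
        exact eq_zero_of_mem_imageLanguage_c₁ (x := []) hab
      obtain ⟨v, rfl⟩ := exists_of_mem_imageLanguage_c₁ (hL ▸ hu) hhead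
      rcases List.eq_nil_or_concat' v with rfl | ⟨v, d, rfl⟩
      · exact absurd rfl hne
      rw [hn] at hw
      rcases h.eq_c₁_or_eq_c₂ (n + 1) with hn' | hn'
      · have hL' : L (n + 1) = imageLanguage c₁ (L (n + 1 + 1)) := by
          rw [h.eq_image (n + 1), hn']
        -- A final 0 may be the block 0 or the beginning of 02, so the extensions are read from `v`,
        -- without its final 0. After two `c₁` in a row, the matrix is that of the second preimage,
        -- two ranks higher.
        rcases eq_or_ne d 0 with rfl | hd
        · have hu₀ : (v ++ [0]).flatMap c₁ = v.flatMap c₁ ++ [0] := by simp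
          have hv : ∀ a b, extensionMatrix (L n) ((v ++ [0]).flatMap c₁) a b = true →
              ∃ b, lastPreimage a :: (v ++ [b]) ∈ L (n + 1) := by
            intro a b hab
            rw [extensionMatrix_eq_true, hL, hu₀] at hab
            have := (factorClosed_imageLanguage _ _).append_left
              (u := a :: (v.flatMap c₁ ++ [0])) (v := [b]) (by simpa using hab)
            rcases (extension_zero_c₁ hX).1 this with h' | h'
            · exact ⟨_, h'⟩
            · exact ⟨_, h'⟩
          have hvhead : v.head? ≠ some 2 := by
            intro hh
            obtain ⟨v', rfl⟩ : ∃ v', v = 2 :: v' := by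
              rcases v with _ | ⟨d, v'⟩
              · simp at hh
              · exact ⟨v', by simpa using hh⟩
            refine hr ⟨0, fun a' b hab => ?_⟩
            obtain ⟨b', hb'⟩ := hv a' b hab
            rw [hL'] at hb'
            have := eq_zero_of_mem_imageLanguage_c₁ (x := []) hb'
            rw [← lastPreimage_lastPreimage a', this, lastPreimage_zero]
          obtain ⟨b', hb'⟩ := hv _ _ h₀
          have hvm : v ∈ L (n + 1) := hX.append_left (hX.append_right (u := [_]) hb')
          obtain ⟨v, rfl⟩ := exists_of_mem_imageLanguage_c₁ (hL' ▸ hvm) hvhead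
          have he : extensionMatrix (L n) ((v.flatMap c₁ ++ [0]).flatMap c₁) =
              extensionMatrix (L (n + 1 + 1)) v := by
            rw [hu₀, hL, hL', extensionMatrix_c₁_c₁ (h.factorClosed _) (h.biextendable _)]
          rw [he] at h₀ ⊢
          refine ih s L h _ _ (h.mem_of_extensionMatrix h₀) ?_
          have h₁ := wordWeight_le_flatMap_c₁ (h.eq_c₁_or_eq_c₂ (n + 1 + 1)) v
          have h₂ := wordWeight_le_flatMap_c₁ (Or.inl rfl) (v.flatMap c₁)
          have h₃ : wordWeight c₁ [0] = 3 := rfl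
          rw [hu₀, wordWeight_append] at hw
          omega
        -- In an image under `c₁` the letter 2 follows only 0, so column 2 of the preimage is empty
        -- and merging leaves column 0 alone.
        · exfalso
          refine hc ⟨0, fun a b hab => ?_⟩
          rw [hL, extensionMatrix_concat_of_ne hX hd] at hab
          rcases letter_cases b with rfl | rfl | rfl
          · rfl
          · simp only [mergeMatrix, Matrix.cons_val_one, Matrix.cons_val_zero,
              extensionMatrix_eq_true, hL'] at hab
            exact absurd hab (not_mem_imageLanguage_of_ne hd)
          · simp [mergeMatrix] at hab
      · have hL' : L (n + 1) = imageLanguage c₂ (L (n + 1 + 1)) := by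
          rw [h.eq_image (n + 1), hn']
        rcases eq_or_ne d 0 with rfl | hd
        · have hu₀ : (v ++ [0]).flatMap c₁ = v.flatMap c₁ ++ [0] := by simp
          have he : extensionMatrix (L n) ((v ++ [0]).flatMap c₁) =
              shiftMatrix (extensionMatrix (L (n + 1)) v) := by
            rw [hu₀, hL, hL', extensionMatrix_concat_zero (hL' ▸ h.biextendable (n + 1))]
          rw [he] at h₀ ⊢
          have hv : v ∈ L (n + 1) := by
            rcases letter_cases b₀ with rfl | rfl | rfl
            · simp [shiftMatrix] at h₀
            · exact h.mem_of_extensionMatrix (a := lastPreimage a₀) (b := 0) h₀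
            · exact h.mem_of_extensionMatrix (a := lastPreimage a₀) (b := 1) h₀
          refine IsGoodTree.shift _ (ih s L h _ _ hv ?_) ⟨_, _, h₀⟩
          have h₃ : wordWeight c₁ [0] = 3 := rfl
          rw [hu₀, wordWeight_append, wordWeight_flatMap_c₁] at hw
          rw [hn']
          omega
        · have he : extensionMatrix (L n) ((v ++ [d]).flatMap c₁) =
              mergeMatrix (extensionMatrix (L (n + 1)) (v ++ [d])) := by
            rw [hL, extensionMatrix_concat_of_ne hX hd]
          rw [he] at h₀ ⊢
          have hv : v ++ [d] ∈ L (n + 1) := by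
            rcases letter_cases b₀ with rfl | rfl | rfl
            · simp only [mergeMatrix, Matrix.cons_val_zero, Bool.or_eq_true] at h₀
              rcases h₀ with h₀ | h₀ <;> exact h.mem_of_extensionMatrix h₀
            · exact h.mem_of_extensionMatrix (a := lastPreimage a₀) (b := 2) h₀
            · simp [mergeMatrix] at h₀
          refine IsGoodTree.merge _ (ih s L h _ _ hv ?_)
          rw [wordWeight_flatMap_c₁, List.length_append, List.length_singleton] at hw
          rw [hn']
          omega
    intro s L h n u hu hw
    rcases h.eq_c₁_or_eq_c₂ n with hn | hn
    · exact key s L h n u hu hn hw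
    · have hu' : mirrorWord u ∈ mirrorLanguage (L n) := by simpa [mirrorLanguage] using hu
      have := key _ _ h.mirror n (mirrorWord u) hu' (by simp only [hn, mirrorSubstitution_c₂])
        (by simpa only [hn, mirrorSubstitution_c₂, wordWeight_c₁_mirrorWord] using hw)
      rw [extensionMatrix_mirrorLanguage, mirrorWord_mirrorWord] at this
      simpa [mirrorMatrix_mirrorMatrix] using IsGoodTree.mirror _ this

theorem isGoodTree {s : ℕ → Substitution (Fin 3)} {L : ℕ → Set (List (Fin 3))} (h : IsChain s L)
    {n : ℕ} {u : List (Fin 3)} (hu : u ∈ L n) : IsGoodTree (extensionMatrix (L n) u) = true :=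
  isGoodTree_of_weight_lt _ s L h n u hu (Nat.lt_succ_self _)

end IsChain

/-! ### From good matrices to extension graphs that are trees -/

/-- If the language of `w` is locally tree-like, then `w` is a tree word. -/
theorem isTree_extensionGraph {w : ℕ → Fin 3} {u : List (Fin 3)}
    (h : IsGoodTree (extensionMatrix (factors w) u) = true) : (extensionGraph w u).IsTree := by
  classical
  set e := extensionMatrix (factors w) u with he
  have hmem : ∀ a b, (a, b) ∈ extensionSet w u ↔ e a b = true := by
    intro a b
    rw [he, extensionMatrix_eq_true]
    rfl
  have hl : ∀ a, a ∈ leftExtensions w u ↔ ∃ b, e a b = true := by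
    intro a
    simp only [leftExtensions, Set.mem_image, Prod.exists, exists_and_right, exists_eq_right, hmem]
  have hrt : ∀ b, b ∈ rightExtensions w u ↔ ∃ a, e a b = true := by
    intro b
    simp only [rightExtensions, Set.mem_image, Prod.exists, exists_eq_right, hmem]
  have adj : ∀ (a : leftExtensions w u) (b : rightExtensions w u), e a b = true →
      (extensionGraph w u).Adj (Sum.inl a) (Sum.inr b) :=
    fun a b hab => Or.inl ⟨a, b, rfl, rfl, (hmem _ _).2 hab⟩
  rw [SimpleGraph.isTree_iff_connected_and_card]
  constructor
  · have reach : ∀ b b' : rightExtensions w u,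
        (extensionGraph w u).Reachable (Sum.inr b) (Sum.inr b') := by
      rintro ⟨b, hb⟩ ⟨b', hb'⟩
      obtain ⟨a, ha⟩ := (hrt b).1 hb
      obtain ⟨a', ha'⟩ := (hrt b').1 hb'
      obtain ⟨a₁, b₁, a₂, h₁, h₂, h₃, h₄⟩ := IsGoodTree.exists_path e h a b a' b' ha ha'
      have q₁ := adj ⟨a₁, (hl _).2 ⟨_, h₁⟩⟩ ⟨b, hb⟩ h₁
      have q₂ := adj ⟨a₁, (hl _).2 ⟨_, h₁⟩⟩ ⟨b₁, (hrt _).2 ⟨_, h₂⟩⟩ h₂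
      have q₃ := adj ⟨a₂, (hl _).2 ⟨_, h₃⟩⟩ ⟨b₁, (hrt _).2 ⟨_, h₂⟩⟩ h₃
      have q₄ := adj ⟨a₂, (hl _).2 ⟨_, h₃⟩⟩ ⟨b', hb'⟩ h₄
      exact (q₁.symm.reachable.trans q₂.reachable).trans (q₃.symm.reachable.trans q₄.reachable)
    have toRight : ∀ x, ∃ b, (extensionGraph w u).Reachable x (Sum.inr b) := by
      rintro (⟨a, ha⟩ | b)
      · obtain ⟨b, hb⟩ := (hl a).1 ha
        exact ⟨⟨b, (hrt b).2 ⟨a, hb⟩⟩, (adj ⟨a, ha⟩ ⟨b, (hrt b).2 ⟨a, hb⟩⟩ hb).reachable⟩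
      · exact ⟨b, SimpleGraph.Reachable.refl _⟩
    obtain ⟨a, b, hab⟩ := IsGoodTree.nonempty e h
    have : Nonempty (leftExtensions w u ⊕ rightExtensions w u) :=
      ⟨Sum.inl ⟨a, (hl a).2 ⟨b, hab⟩⟩⟩
    refine ⟨fun x y => ?_⟩
    obtain ⟨b, hb⟩ := toRight x
    obtain ⟨b', hb'⟩ := toRight y
    exact (hb.trans (reach b b')).trans hb'.symm
  · have hcard := IsGoodTree.card_eq e h
    have h₁ : Nat.card (leftExtensions w u) = Fintype.card {a // ∃ b, e a b = true} := by
      rw [← Nat.card_eq_fintype_card]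
      exact Nat.card_congr (Equiv.subtypeEquivRight hl)
    have h₂ : Nat.card (rightExtensions w u) = Fintype.card {b // ∃ a, e a b = true} := by
      rw [← Nat.card_eq_fintype_card]
      exact Nat.card_congr (Equiv.subtypeEquivRight hrt)
    rw [Nat.card_sum, h₁, h₂, ← hcard, ← Nat.card_eq_fintype_card]
    congr 1
    symm
    refine Nat.card_congr (Equiv.ofBijective (fun p => ⟨s(Sum.inl ⟨p.1.1, (hl _).2 ⟨_, p.2⟩⟩,
      Sum.inr ⟨p.1.2, (hrt _).2 ⟨_, p.2⟩⟩), adj _ _ p.2⟩) ⟨?_, ?_⟩)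
    · rintro ⟨⟨a, b⟩, hab⟩ ⟨⟨a', b'⟩, hab'⟩ hh
      simpa using congrArg Subtype.val hh
    · rintro ⟨z, hz⟩
      induction z using Sym2.ind with
      | _ x y =>
        have hz' : (extensionGraph w u).Adj x y := hz
        rcases hz' with ⟨a, b, rfl, rfl, hab⟩ | ⟨a, b, rfl, rfl, hab⟩
        · exact ⟨⟨(a, b), (hmem _ _).1 hab⟩, rfl⟩
        · exact ⟨⟨(a, b), (hmem _ _).1 hab⟩, Subtype.ext Sym2.eq_swap⟩

/-! ### The languages generated by a primitive directive sequence -/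

section Compose

variable {A : Type*} {s : ℕ → Substitution A}

theorem compose_append (r k : ℕ) (u v : List A) :
    compose s r k (u ++ v) = compose s r k u ++ compose s r k v := by
  induction k generalizing u v with
  | zero => rfl
  | succ k ih => simp [compose, ih]

theorem compose_nil (r k : ℕ) : compose s r k [] = [] := by
  induction k with
  | zero => rfl
  | succ k ih => simpa [compose] using ih

theorem compose_eq_flatMap (r k : ℕ) (u : List A) :
    compose s r k u = u.flatMap fun a => compose s r k [a] := by
  induction u with
  | nil => exact compose_nil r k
  | cons a u ih => rw [← List.singleton_append, compose_append, ih]; simp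

theorem compose_add (r j k : ℕ) (u : List A) :
    compose s r (j + k) u = compose s r j (compose s (r + j) k u) := by
  induction k generalizing u with
  | zero => rfl
  | succ k ih => rw [← add_assoc, compose, ih, compose, add_assoc]

theorem compose_succ' (r k : ℕ) (u : List A) :
    compose s r (k + 1) u = (compose s (r + 1) k u).flatMap (s r) := by
  rw [add_comm, compose_add]
  rfl

theorem infix_flatMap {B : Type*} {u v : List A} (h : u <:+: v) (f : A → List B) :
    u.flatMap f <:+: v.flatMap f := by
  obtain ⟨p, q, rfl⟩ := h
  exact ⟨p.flatMap f, q.flatMap f, by simp⟩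

theorem compose_infix {r k : ℕ} {u v : List A} (h : u <:+: v) :
    compose s r k u <:+: compose s r k v := by
  rw [compose_eq_flatMap, compose_eq_flatMap r k v]
  exact infix_flatMap h _

theorem singleton_infix {a : A} {u : List A} (h : a ∈ u) : [a] <:+: u := by
  obtain ⟨p, q, rfl⟩ := List.append_of_mem h
  exact ⟨p, q, by simp⟩

theorem compose_ne_nil (hs : ∀ n a, s n a ≠ []) {r k : ℕ} {u : List A} (hu : u ≠ []) :
    compose s r k u ≠ [] := by
  induction k generalizing u with
  | zero => exact hu
  | succ k ih =>
    apply ih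
    obtain ⟨a, u, rfl⟩ := List.exists_cons_of_ne_nil hu
    simp [hs]

/-- The language generated by the directive sequence from rank `r` on. -/
def language (s : ℕ → Substitution A) (r : ℕ) : Set (List A) :=
  {u | ∃ k a, u <:+: compose s r k [a]}

theorem exists_forall_infix_compose (hp : IsPrimitive s) {r : ℕ} {u : List A}
    (hu : u ∈ language s r) : ∃ k, ∀ b, u <:+: compose s r k [b] := by
  obtain ⟨k, a, h⟩ := hu
  obtain ⟨r', -, h'⟩ := hp (r + k)
  refine ⟨k + (r' - (r + k)), fun b => ?_⟩
  rw [compose_add]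
  exact h.trans (compose_infix (singleton_infix (h' b a)))

theorem language_eq_imageLanguage [Nonempty A] (hs : ∀ n a, s n a ≠ []) (hp : IsPrimitive s)
    (r : ℕ) : language s r = imageLanguage (s r) (language s (r + 1)) := by
  ext u
  constructor
  · intro hu
    obtain ⟨k, h⟩ := exists_forall_infix_compose hp hu
    obtain ⟨a⟩ := ‹Nonempty A›
    obtain ⟨b, y, hb⟩ := List.exists_cons_of_ne_nil (hs (r + k) a)
    -- Since `u` occurs in the depth-`k` image of every letter, it occurs in that of the first
    -- letter of `s (r + k) a`, hence one level deeper in the image of `a`.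
    refine ⟨compose s (r + 1) k [a], ⟨k, a, List.infix_rfl⟩, ?_⟩
    rw [← compose_succ', compose]
    refine (h b).trans (compose_infix (singleton_infix ?_))
    simp [hb]
  · rintro ⟨y, ⟨k, a, hy⟩, h⟩
    refine ⟨k + 1, a, ?_⟩
    rw [compose_succ']
    exact h.trans (infix_flatMap hy _)

/-- Some deep image contains three distinct letters and so has length at least three. An occurrence
of `u` inside the image of its second letter has nonempty images on both sides. -/
theorem biextendable_language (hs : ∀ n a, s n a ≠ []) (hp : IsPrimitive s) {x y z : A}
    (hxy : x ≠ y) (hxz : x ≠ z) (hyz : y ≠ z) (r : ℕ) : Biextendable (language s r) := by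
  classical
  intro u hu
  obtain ⟨k, h⟩ := exists_forall_infix_compose hp hu
  obtain ⟨r', -, h'⟩ := hp (r + k)
  set m := r' - (r + k)
  have hlen : 3 ≤ (compose s (r + k) m [x]).length := by
    have h3 : ({x, y, z} : Finset A).card = 3 := Finset.card_eq_three.2
      ⟨x, y, z, hxy, hxz, hyz, rfl⟩
    rw [← h3]
    refine (Finset.card_le_card fun c _ => ?_).trans (List.toFinset_card_le _)
    exact List.mem_toFinset.2 (h' x c)
  match hw : compose s (r + k) m [x], hlen with
  | c :: d :: e :: t, _ =>
    obtain ⟨p, q, hpq⟩ := h d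
    have hc : compose s r k [c] ++ p ≠ [] := by
      simp [compose_ne_nil hs (List.cons_ne_nil c [])]
    have he : q ++ compose s r k [e] ≠ [] := by
      simp [compose_ne_nil hs (List.cons_ne_nil e [])]
    obtain ⟨p', a, hp'⟩ := (List.eq_nil_or_concat' _).resolve_left hc
    obtain ⟨b, q', hq'⟩ := List.exists_cons_of_ne_nil he
    refine ⟨a, b, k + m, x, p', q' ++ compose s r k t, ?_⟩
    rw [compose_add, hw]
    have e₁ : c :: d :: e :: t = [c] ++ ([d] ++ ([e] ++ t)) := rfl
    rw [e₁, compose_append, compose_append, compose_append, ← hpq]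
    calc p' ++ a :: (u ++ [b]) ++ (q' ++ compose s r k t)
        = (p' ++ [a]) ++ u ++ (b :: q') ++ compose s r k t := by simp
      _ = _ := by rw [← hp', ← hq']; simp

end Compose

/-! ### Windows of an infinite word -/

section Window

variable {A : Type*} {w : ℕ → A}

@[simp] theorem length_window (i n : ℕ) : (window w i n).length = n := by simp [window]

theorem window_add (i m n : ℕ) : window w i (m + n) = window w i m ++ window w (i + m) n := by
  simp [window, List.range_add, add_assoc]

theorem window_mem_factors (i n : ℕ) : window w i n ∈ factors w := ⟨i, by simp⟩

theorem mem_factors_of_infix_window {u : List A} {i n : ℕ} (h : u <:+: window w i n) :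
    u ∈ factors w := by
  obtain ⟨p, q, hpq⟩ := h
  have hn : n = p.length + u.length + q.length := by
    rw [← length_window (w := w) i n, ← hpq]; simp [add_assoc]
  rw [hn, window_add, window_add] at hpq
  have h₁ := (List.append_inj hpq (by simp)).1
  exact ⟨_, (List.append_inj h₁ (by simp)).2.symm⟩

/-- The end of the block in which `v` starts uses at most `M` letters, and the next block fits into
the remaining `M`. -/
theorem exists_block_infix {B : Type*} {f : B → List A} {M : ℕ} (hM : 0 < M)
    (hf : ∀ b, (f b).length ≤ M) {l : List B} {p v q : List A} (h : l.flatMap f = p ++ v ++ q)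
    (hv : 2 * M ≤ v.length) : ∃ b, f b <:+: v := by
  induction l generalizing p with
  | nil =>
    simp only [List.flatMap_nil, List.nil_eq, List.append_eq_nil_iff] at h
    rw [h.1.2] at hv
    simp at hv
    omega
  | cons b l ih =>
    rw [List.flatMap_cons, List.append_assoc] at h
    rcases List.append_eq_append_iff.1 h with ⟨p', rfl, h'⟩ | ⟨t, ht, h'⟩
    · exact ih (p := p') (by rw [h', List.append_assoc])
    · rcases List.append_eq_append_iff.1 h' with ⟨v', hv', -⟩ | ⟨v', rfl, h''⟩
      · have := hf b
        rw [ht, List.length_append] at this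
        have h3 := congrArg List.length hv'
        rw [List.length_append] at h3
        omega
      · have htl := hf b
        rw [ht, List.length_append] at htl
        rw [List.length_append] at hv
        rcases l with _ | ⟨b', l⟩
        · simp only [List.flatMap_nil, List.nil_eq, List.append_eq_nil_iff] at h''
          rw [h''.1] at hv
          simp at hv
          omega
        · rw [List.flatMap_cons] at h''
          have hb' := hf b'
          have hpre : f b' <+: v' :=
            List.prefix_of_prefix_length_le ⟨_, h''⟩ ⟨q, rfl⟩ (by omega)
          exact ⟨b', hpre.isInfix.trans (List.suffix_append t v').isInfix⟩

end Window

/-! ### Factors and uniform recurrence of a primitive S-adic word -/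

section Representation

variable {A : Type*} {s : ℕ → Substitution A} {a w : ℕ → A}

theorem exists_length_compose_le [Finite A] (s : ℕ → Substitution A) (r k : ℕ) :
    ∃ M, 0 < M ∧ ∀ b, (compose s r k [b]).length ≤ M := by
  obtain ⟨M, hM⟩ := (Set.finite_range fun b => (compose s r k [b]).length).bddAbove
  exact ⟨M + 1, by omega, fun b => (hM ⟨b, rfl⟩).trans (Nat.le_succ M)⟩

theorem IsRepresentation.exists_prefix (h : IsRepresentation s a w) (k N : ℕ) :
    ∃ l : List A, window w 0 N <+: l.flatMap fun b => compose s 0 k [b] := by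
  obtain ⟨n, hn, hk⟩ := ((h N).and (eventually_ge_atTop k)).exists
  refine ⟨compose s (0 + k) (n - k) [a n], ?_⟩
  rwa [← compose_eq_flatMap, ← compose_add, Nat.add_sub_cancel' hk]

theorem IsRepresentation.exists_compose_infix [Finite A] (h : IsRepresentation s a w) (k : ℕ) :
    ∃ N, ∀ v ∈ factors w, v.length = N → ∃ b, compose s 0 k [b] <:+: v := by
  obtain ⟨M, hM, hf⟩ := exists_length_compose_le s 0 k
  refine ⟨2 * M, ?_⟩
  rintro v ⟨i, hi⟩ hv
  obtain ⟨l, q, hq⟩ := h.exists_prefix k (i + v.length)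
  rw [window_add, zero_add, hi] at hq
  exact exists_block_infix hM hf hq.symm hv.ge

theorem IsRepresentation.factors_eq_language [Finite A] (h : IsRepresentation s a w) (hp : IsPrimitive s) :
    factors w = language s 0 := by
  ext u
  constructor
  · rintro ⟨i, hi⟩
    obtain ⟨n, hn⟩ := (h (i + u.length)).exists
    refine ⟨n, a n, List.IsInfix.trans ?_ hn.isInfix⟩
    rw [window_add, zero_add, hi]
    exact (List.suffix_append _ _).isInfix
  · intro hu
    obtain ⟨k, hk⟩ := exists_forall_infix_compose hp hu
    obtain ⟨N, hN⟩ := h.exists_compose_infix k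
    obtain ⟨b, hb⟩ := hN _ (window_mem_factors 0 N) (by simp)
    exact mem_factors_of_infix_window ((hk b).trans hb)

theorem IsRepresentation.isUniformlyRecurrent [Finite A] (h : IsRepresentation s a w)
    (hp : IsPrimitive s) : IsUniformlyRecurrent w := by
  intro u hu
  rw [h.factors_eq_language hp] at hu
  obtain ⟨k, hk⟩ := exists_forall_infix_compose hp hu
  obtain ⟨N, hN⟩ := h.exists_compose_infix k
  refine ⟨N, fun v hv hl => ?_⟩
  obtain ⟨b, hb⟩ := hN v hv hl
  exact (hk b).trans hb

end Representation

theorem ne_nil_of_mem_cassaigneSet {σ : Substitution (Fin 3)} (h : σ ∈ cassaigneSet) (a : Fin 3) :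
    σ a ≠ [] := by
  rcases h with rfl | rfl <;> rcases letter_cases a with rfl | rfl | rfl <;> simp

theorem isChain_language {s : ℕ → Substitution (Fin 3)} (hs : ∀ n, s n ∈ cassaigneSet)
    (hp : IsPrimitive s) : IsChain s (language s) where
  mem := hs
  eq_image := language_eq_imageLanguage (fun n => ne_nil_of_mem_cassaigneSet (hs n)) hp
  biextendable := biextendable_language (x := 0) (y := 1) (z := 2)
    (fun n => ne_nil_of_mem_cassaigneSet (hs n)) hp (by decide) (by decide) (by decide)
  letter_mem _ a := ⟨0, a, List.infix_rfl⟩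

/-! ### Complexity from the edge count of trees -/

section Complexity

/-- The number of words of length `n` in `X`. -/
noncomputable def wordCount (X : Set (List (Fin 3))) (n : ℕ) : ℕ :=
  Nat.card {u : List (Fin 3) // u ∈ X ∧ u.length = n}

instance (X : Set (List (Fin 3))) (n : ℕ) :
    Finite {u : List (Fin 3) // u ∈ X ∧ u.length = n} :=
  ((List.finite_length_eq (Fin 3) n).subset fun _ h => h.2 : Set.Finite
    {u : List (Fin 3) | u ∈ X ∧ u.length = n}).to_subtype

variable {X : Set (List (Fin 3))}

theorem wordCount_succ_left (hX : FactorClosed X) (hb : Biextendable X) (n : ℕ)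
    [Fintype {u : List (Fin 3) // u ∈ X ∧ u.length = n}] :
    wordCount X (n + 1) = ∑ u : {u : List (Fin 3) // u ∈ X ∧ u.length = n},
      Nat.card {a // ∃ b, extensionMatrix X u a b = true} := by
  rw [← Nat.card_sigma]
  symm
  have hmem : ∀ (a : Fin 3) (u : List (Fin 3)), a :: u ∈ X ↔
      ∃ b, extensionMatrix X u a b = true := by
    intro a u
    simp only [extensionMatrix_eq_true]
    exact ⟨fun h => hb.exists_append hX h, fun ⟨b, h⟩ => hX.append_left (v := [b]) h⟩
  refine Nat.card_congr (Equiv.ofBijective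
    (fun p => ⟨p.2.1 :: p.1.1, (hmem _ _).2 p.2.2, by simp [p.1.2.2]⟩) ⟨?_, ?_⟩)
  · rintro ⟨⟨u, hu⟩, a, ha⟩ ⟨⟨u', hu'⟩, a', ha'⟩ h
    obtain ⟨rfl, rfl⟩ := List.cons.inj (congrArg Subtype.val h)
    rfl
  · rintro ⟨v, hv, hl⟩
    rcases v with _ | ⟨a, u⟩
    · simp at hl
    · exact ⟨⟨⟨u, hX.append_right (u := [a]) hv, by simpa using hl⟩, a, (hmem _ _).1 hv⟩, rfl⟩

theorem wordCount_succ_right (hX : FactorClosed X) (hb : Biextendable X) (n : ℕ)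
    [Fintype {u : List (Fin 3) // u ∈ X ∧ u.length = n}] :
    wordCount X (n + 1) = ∑ u : {u : List (Fin 3) // u ∈ X ∧ u.length = n},
      Nat.card {b // ∃ a, extensionMatrix X u a b = true} := by
  rw [← Nat.card_sigma]
  symm
  have hmem : ∀ (b : Fin 3) (u : List (Fin 3)), u ++ [b] ∈ X ↔
      ∃ a, extensionMatrix X u a b = true := by
    intro b u
    simp only [extensionMatrix_eq_true]
    refine ⟨fun h => ?_, fun ⟨a, h⟩ => hX.append_right (u := [a]) h⟩
    obtain ⟨a, d, had⟩ := hb _ h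
    exact ⟨a, hX.append_left (u := a :: (u ++ [b])) had⟩
  refine Nat.card_congr (Equiv.ofBijective
    (fun p => ⟨p.1.1 ++ [p.2.1], (hmem _ _).2 p.2.2, by simp [p.1.2.2]⟩) ⟨?_, ?_⟩)
  · rintro ⟨⟨u, hu⟩, a, ha⟩ ⟨⟨u', hu'⟩, a', ha'⟩ h
    obtain ⟨rfl, h'⟩ := List.append_inj' (congrArg Subtype.val h) rfl
    obtain rfl : a = a' := by simpa using h'
    rfl
  · rintro ⟨v, hv, hl⟩
    rcases List.eq_nil_or_concat' v with rfl | ⟨u, b, rfl⟩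
    · simp at hl
    · exact ⟨⟨⟨u, hX.append_left hv, by simpa using hl⟩, b, (hmem _ _).1 hv⟩, rfl⟩

theorem wordCount_add_two (hX : FactorClosed X) (n : ℕ)
    [Fintype {u : List (Fin 3) // u ∈ X ∧ u.length = n}] :
    wordCount X (n + 2) = ∑ u : {u : List (Fin 3) // u ∈ X ∧ u.length = n},
      Nat.card {p : Fin 3 × Fin 3 // extensionMatrix X u p.1 p.2 = true} := by
  rw [← Nat.card_sigma]
  symm
  refine Nat.card_congr (Equiv.ofBijective
    (fun p => ⟨p.2.1.1 :: (p.1.1 ++ [p.2.1.2]), by simpa using p.2.2, by simp [p.1.2.2]⟩) ⟨?_, ?_⟩)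
  · rintro ⟨⟨u, hu⟩, ⟨a, b⟩, ha⟩ ⟨⟨u', hu'⟩, ⟨a', b'⟩, ha'⟩ h
    obtain ⟨rfl, h'⟩ := List.cons.inj (congrArg Subtype.val h)
    obtain ⟨rfl, h''⟩ := List.append_inj' h' rfl
    obtain rfl : b = b' := by simpa using h''
    rfl
  · rintro ⟨v, hv, hl⟩
    rcases v with _ | ⟨a, v⟩
    · simp at hl
    · rcases List.eq_nil_or_concat' v with rfl | ⟨u, b, rfl⟩
      · simp at hl
      · exact ⟨⟨⟨u, hX.append_left (hX.append_right (u := [a]) hv), by simpa using hl⟩, (a, b),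
          by simpa using hv⟩, rfl⟩

theorem wordCount_eq (hX : FactorClosed X) (hb : Biextendable X) (hl : ∀ a, [a] ∈ X)
    (hg : ∀ u ∈ X, IsGoodTree (extensionMatrix X u) = true) (n : ℕ) :
    wordCount X n = 2 * n + 1 := by
  -- Summing edges + 1 = left + right over words of length `n`: edges count words of length `n + 2`,
  -- each kind of vertex counts words of length `n + 1`.
  have hrec : ∀ n, wordCount X (n + 2) + wordCount X n =
      wordCount X (n + 1) + wordCount X (n + 1) := by
    intro n
    have := Fintype.ofFinite {u : List (Fin 3) // u ∈ X ∧ u.length = n}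
    have h₀ : wordCount X n = ∑ _u : {u : List (Fin 3) // u ∈ X ∧ u.length = n}, 1 := by
      simp [wordCount]
    have h₁ := wordCount_succ_right hX hb n
    rw [wordCount_add_two hX, h₀]
    nth_rw 2 [h₁]
    rw [wordCount_succ_left hX hb, ← Finset.sum_add_distrib, ← Finset.sum_add_distrib]
    refine Finset.sum_congr rfl fun u _ => ?_
    simpa only [Nat.card_eq_fintype_card] using IsGoodTree.card_eq _ (hg u u.2.1)
  have h0 : wordCount X 0 = 1 := by
    rw [wordCount, Nat.card_eq_one_iff_unique]
    refine ⟨⟨?_⟩, ⟨⟨[], hX.append_left (u := []) (hl 0), rfl⟩⟩⟩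
    rintro ⟨u, hu, hu'⟩ ⟨v, hv, hv'⟩
    rw [List.length_eq_zero_iff] at hu' hv'
    simp [hu', hv']
  have h1 : wordCount X 1 = 3 := by
    refine Eq.trans (Eq.symm ?_) (Nat.card_fin 3)
    refine Nat.card_congr (Equiv.ofBijective (fun a => ⟨[a], hl a, rfl⟩) ⟨?_, ?_⟩)
    · intro a b h
      simpa using h
    · rintro ⟨u, hu, hu'⟩
      obtain ⟨a, rfl⟩ := List.length_eq_one_iff.1 hu'
      exact ⟨a, rfl⟩
  have key : ∀ n, wordCount X n = 2 * n + 1 ∧ wordCount X (n + 1) = 2 * (n + 1) + 1 := by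
    intro n
    induction n with
    | zero => exact ⟨h0, h1⟩
    | succ n ih => exact ⟨ih.2, by
      have h₂ := hrec n
      change wordCount X (n + 2) = _
      omega⟩
  exact (key n).1

end Complexity

theorem IsPrimitiveSAdic.isChain_factors {w : ℕ → Fin 3} (h : IsPrimitiveSAdic cassaigneSet w) :
    ∃ s L, IsChain s L ∧ factors w = L 0 := by
  obtain ⟨s, a, hs, hp, hr⟩ := h
  exact ⟨s, language s, isChain_language hs hp, hr.factors_eq_language hp⟩

theorem IsPrimitiveSAdic.isTreeWord {w : ℕ → Fin 3} (h : IsPrimitiveSAdic cassaigneSet w) :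
    IsTreeWord w := by
  obtain ⟨s, L, hc, hw⟩ := h.isChain_factors
  intro u hu
  refine isTree_extensionGraph ?_
  rw [hw]
  exact hc.isGoodTree (hw ▸ hu.1)

theorem IsPrimitiveSAdic.complexity_eq {w : ℕ → Fin 3} (h : IsPrimitiveSAdic cassaigneSet w)
    (n : ℕ) : complexity w n = 2 * n + 1 := by
  obtain ⟨s, L, hc, hw⟩ := h.isChain_factors
  rw [← wordCount_eq (hc.factorClosed 0) (hc.biextendable 0) (hc.letter_mem 0)
    (fun u hu => hc.isGoodTree hu) n, complexity, hw]
  rfl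

/-! ### Cassaigne's algorithm: the limit cone is a ray -/

/-- The inverse of the action of `c₁` (for `true`) or `c₂` (for `false`) on the vectors of numbers
of occurrences of letters. -/
def pull (b : Bool) (x : Fin 3 → ℝ) : Fin 3 → ℝ :=
  bif b then ![x 0 - x 2, x 2, x 1] else ![x 1, x 0, x 2 - x 0]

@[simp] theorem pull_true (x : Fin 3 → ℝ) : pull true x = ![x 0 - x 2, x 2, x 1] := rfl
@[simp] theorem pull_false (x : Fin 3 → ℝ) : pull false x = ![x 1, x 0, x 2 - x 0] := rfl

/-- The iterated action of `pull` along the sequence `d`. -/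
def orbit (d : ℕ → Bool) : ℕ → (Fin 3 → ℝ) → Fin 3 → ℝ
  | 0, x => x
  | n + 1, x => pull (d n) (orbit d n x)

variable {d : ℕ → Bool}

theorem pull_sub_smul (b : Bool) (x y : Fin 3 → ℝ) (t : ℝ) :
    pull b (x - t • y) = pull b x - t • pull b y := by
  funext i
  cases b <;> fin_cases i <;> simp <;> ring

theorem orbit_sub_smul (n : ℕ) (x y : Fin 3 → ℝ) (t : ℝ) :
    orbit d n (x - t • y) = orbit d n x - t • orbit d n y := by
  induction n with
  | zero => rfl
  | succ n ih => simp only [orbit, ih, pull_sub_smul]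

theorem orbit_zero (n : ℕ) : orbit d n 0 = 0 := by
  simpa using orbit_sub_smul (d := d) n 0 0 1

theorem orbit_smul (n : ℕ) (x : Fin 3 → ℝ) (t : ℝ) : orbit d n (t • x) = t • orbit d n x := by
  simpa [orbit_zero] using orbit_sub_smul (d := d) n 0 x (-t)

theorem orbit_add (m n : ℕ) (x : Fin 3 → ℝ) :
    orbit d (m + n) x = orbit (fun k => d (m + k)) n (orbit d m x) := by
  induction n with
  | zero => rfl
  | succ n ih => rw [← add_assoc, orbit, ih, orbit]

theorem continuous_pull (b : Bool) : Continuous (pull b) := by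
  cases b <;> refine continuous_pi fun i => ?_ <;> fin_cases i <;>
  simp only [pull_true, pull_false] <;> simp <;> fun_prop

theorem continuous_orbit (d : ℕ → Bool) (n : ℕ) : Continuous (orbit d n) := by
  induction n with
  | zero => exact continuous_id
  | succ n ih => exact (continuous_pull _).comp ih

/-- The partial sums entering the Selmer form of the algorithm are nonnegative. -/
def HasNonnegSums (x : Fin 3 → ℝ) : Prop :=
  0 ≤ x 0 + x 1 ∧ 0 ≤ x 1 + x 2 ∧ 0 ≤ x 0 + x 1 + x 2

/-- The partial sums entering the Selmer form of the algorithm are positive. -/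
def HasPosSums (x : Fin 3 → ℝ) : Prop :=
  0 < x 0 + x 1 ∧ 0 < x 1 + x 2 ∧ 0 < x 0 + x 1 + x 2

/-- In either branch, two of the three sums for `x` are sums for its image and the third is the sum
of the two pair sums of that image. -/
theorem HasNonnegSums.of_pull {b : Bool} {x : Fin 3 → ℝ} (h : HasNonnegSums (pull b x)) :
    HasNonnegSums x := by
  obtain ⟨h₁, h₂, h₃⟩ := h
  cases b <;> simp at h₁ h₂ h₃ <;> refine ⟨?_, ?_, ?_⟩ <;> linarith

theorem HasPosSums.of_pull {b : Bool} {x : Fin 3 → ℝ} (h : HasPosSums (pull b x)) :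
    HasPosSums x := by
  obtain ⟨h₁, h₂, h₃⟩ := h
  cases b <;> simp at h₁ h₂ h₃ <;> refine ⟨?_, ?_, ?_⟩ <;> linarith

theorem HasNonnegSums.orbit_of_le {x : Fin 3 → ℝ} {m n : ℕ} (hmn : m ≤ n)
    (h : HasNonnegSums (orbit d n x)) : HasNonnegSums (orbit d m x) := by
  induction n, hmn using Nat.le_induction with
  | base => exact h
  | succ n _ ih => exact ih h.of_pull

theorem HasPosSums.of_orbit {x : Fin 3 → ℝ} {n : ℕ} (h : HasPosSums (orbit d n x)) :
    HasPosSums x := by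
  induction n with
  | zero => exact h
  | succ n ih => exact ih h.of_pull

/-- From no rank on is the sequence made of blocks of two equal terms. -/
def IsNonDegenerate (d : ℕ → Bool) : Prop :=
  ∀ n, ∃ k, d (n + 2 * k) ≠ d (n + 2 * k + 1)

theorem orbit_add_two (n : ℕ) (x : Fin 3 → ℝ) :
    orbit d (n + 2) x = pull (d (n + 1)) (pull (d n) (orbit d n x)) := rfl

theorem orbit_add_two_one {n : ℕ} (h : d n = d (n + 1)) (x : Fin 3 → ℝ) :
    orbit d (n + 2) x 1 = orbit d n x 1 := by
  rw [orbit_add_two, ← h]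
  cases d n <;> simp

/-- After two different branches the middle entry reappears as one of the pair sums two ranks later.
-/
theorem orbit_one_nonneg_of_ne {v : Fin 3 → ℝ} (hv : ∀ n, HasNonnegSums (orbit d n v)) {n : ℕ}
    (h : d n ≠ d (n + 1)) : 0 ≤ orbit d n v 1 := by
  have h₁ := (hv (n + 2)).1
  have h₂ := (hv (n + 2)).2.1
  rw [orbit_add_two] at h₁ h₂
  cases e : d n <;> cases e' : d (n + 1) <;> simp_all

theorem orbit_one_nonneg {v : Fin 3 → ℝ} (hv : ∀ n, HasNonnegSums (orbit d n v)) (k : ℕ) :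
    ∀ n, d (n + 2 * k) ≠ d (n + 2 * k + 1) → 0 ≤ orbit d n v 1 := by
  induction k with
  | zero => exact fun n h => orbit_one_nonneg_of_ne hv h
  | succ k ih =>
    intro n h
    by_cases hn : d n = d (n + 1)
    · rw [← orbit_add_two_one hn]
      refine ih _ ?_
      rwa [show n + 2 * (k + 1) = n + 2 + 2 * k by ring] at h
    · exact orbit_one_nonneg_of_ne hv hn

theorem orbit_nonneg_of_hasNonnegSums (hd : IsNonDegenerate d) {v : Fin 3 → ℝ}
    (hv : ∀ n, HasNonnegSums (orbit d n v)) (n : ℕ) (i : Fin 3) : 0 ≤ orbit d n v i := by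
  have hmid : ∀ n, 0 ≤ orbit d n v 1 := fun n => (hd n).elim fun k hk => orbit_one_nonneg hv k n hk
  have h₀ := hmid n
  have h₁ := hmid (n + 1)
  have h₂ := hv (n + 1)
  rw [orbit] at h₁ h₂
  obtain ⟨h₂, h₃, -⟩ := h₂
  cases e : d n <;> simp [e] at h₁ h₂ h₃ <;> rcases letter_cases i with rfl | rfl | rfl <;>
    assumption

/-- Nonnegativity of the next two iterates bounds each outer entry by the sum of the other two, up
to nonnegative terms, so no pair sum is less than half of the total. -/
theorem sum_le_of_ne {v : Fin 3 → ℝ} (hv : ∀ n i, 0 ≤ orbit d n v i) {n : ℕ}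
    (h : d n ≠ d (n + 1)) :
    orbit d n v 0 + orbit d n v 1 + orbit d n v 2 ≤ 2 * (orbit d n v 0 + orbit d n v 1) ∧
    orbit d n v 0 + orbit d n v 1 + orbit d n v 2 ≤ 2 * (orbit d n v 1 + orbit d n v 2) := by
  have h₀ := hv n
  have h₁ := hv (n + 1)
  have h₂ := hv (n + 2)
  rw [orbit_add_two] at h₂
  rw [orbit] at h₁
  have a₁ := h₀ 0
  have a₂ := h₀ 1
  have a₃ := h₀ 2
  have b₁ := h₁ 0
  have b₂ := h₁ 2
  have e₁ := h₂ 0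
  have e₂ := h₂ 2
  cases e : d n <;> cases e' : d (n + 1) <;> simp [e, e'] at h b₁ b₂ e₁ e₂ <;>
  constructor <;> linarith

/-- A block of two equal branches fixes the middle entry and lowers the total by at least that
entry; endlessly many such blocks in a row would make the total negative. -/
theorem isNonDegenerate_of_orbit_pos {x : Fin 3 → ℝ} (hx : ∀ n i, 0 < orbit d n x i) :
    IsNonDegenerate d := by
  by_contra hd
  simp only [IsNonDegenerate, not_forall, not_exists, not_not] at hd
  obtain ⟨n, hn⟩ := hd
  have hmid : ∀ k, orbit d (n + 2 * k) x 1 = orbit d n x 1 := by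
    intro k
    induction k with
    | zero => rfl
    | succ k ih =>
      rw [show n + 2 * (k + 1) = n + 2 * k + 2 by ring, orbit_add_two_one (hn k), ih]
  have hsum : ∀ k : ℕ, ∑ i, orbit d (n + 2 * k) x i ≤
      ∑ i, orbit d n x i - k * orbit d n x 1 := by
    intro k
    induction k with
    | zero => simp
    | succ k ih =>
      have h₀ := (hx (n + 2 * k) 0).le
      have h₂ := (hx (n + 2 * k) 2).le
      have h₁ := hmid k
      rw [show n + 2 * (k + 1) = n + 2 * k + 2 by ring, orbit_add_two, ← hn k]
      push_cast
      rw [Fin.sum_univ_three] at ih ⊢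
      cases e : d (n + 2 * k) <;> simp <;> linarith
  obtain ⟨k, hk⟩ := exists_nat_gt ((∑ i, orbit d n x i) / orbit d n x 1)
  rw [div_lt_iff₀ (hx n 1)] at hk
  have h₁ := hsum k
  have h₂ : 0 ≤ ∑ i, orbit d (n + 2 * k) x i := Finset.sum_nonneg fun i _ => (hx _ i).le
  linarith

/-- Subtract from `p` the largest multiple of `x` that keeps all sums nonnegative. The sums are used
because their nonnegativity passes to earlier ranks and, at all ranks together, implies that of the
entries. If the difference were not zero, balance at ranks where the branch changes would allow more
to be subtracted. -/
theorem exists_eq_smul_of_orbit_nonneg {x p : Fin 3 → ℝ} (hx : ∀ n i, 0 < orbit d n x i)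
    (hp : ∀ n i, 0 ≤ orbit d n p i) : ∃ t : ℝ, p = t • x := by
  have hd := isNonDegenerate_of_orbit_pos hx
  set S : Set ℝ := {t | ∀ n, HasNonnegSums (orbit d n (p - t • x))} with hS
  have h0 : (0 : ℝ) ∈ S := by
    intro n
    have h₀ := hp n 0
    have h₁ := hp n 1
    have h₂ := hp n 2
    simp only [zero_smul, sub_zero]
    exact ⟨by linarith, by linarith, by linarith⟩
  have hxs : ∀ n, HasPosSums (orbit d n x) := by
    intro n
    have h₀ := hx n 0
    have h₁ := hx n 1
    have h₂ := hx n 2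
    exact ⟨by linarith, by linarith, by linarith⟩
  have hmem : ∀ t, t ∈ S ↔ ∀ n,
      t ≤ (orbit d n p 0 + orbit d n p 1) / (orbit d n x 0 + orbit d n x 1) ∧
      t ≤ (orbit d n p 1 + orbit d n p 2) / (orbit d n x 1 + orbit d n x 2) ∧
      t ≤ (orbit d n p 0 + orbit d n p 1 + orbit d n p 2) /
        (orbit d n x 0 + orbit d n x 1 + orbit d n x 2) := by
    intro t
    refine forall_congr' fun n => ?_
    obtain ⟨h₁, h₂, h₃⟩ := hxs n
    rw [orbit_sub_smul, le_div_iff₀ h₁, le_div_iff₀ h₂, le_div_iff₀ h₃]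
    simp only [HasNonnegSums, Pi.sub_apply, Pi.smul_apply, smul_eq_mul]
    constructor
    · rintro ⟨h₁, h₂, h₃⟩
      exact ⟨by linarith, by linarith, by linarith⟩
    · rintro ⟨h₁, h₂, h₃⟩
      exact ⟨by linarith, by linarith, by linarith⟩
  have hbdd : BddAbove S := ⟨_, fun t ht => ((hmem t).1 ht 0).1⟩
  -- `S` is an intersection of closed half-lines.
  have hsup : sSup S ∈ S := by
    rw [hmem]
    intro n
    exact ⟨csSup_le ⟨0, h0⟩ fun t ht => ((hmem t).1 ht n).1,
      csSup_le ⟨0, h0⟩ fun t ht => ((hmem t).1 ht n).2.1,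
      csSup_le ⟨0, h0⟩ fun t ht => ((hmem t).1 ht n).2.2⟩
  refine ⟨sSup S, ?_⟩
  set q := p - sSup S • x with hq
  have hqn : ∀ n i, 0 ≤ orbit d n q i := orbit_nonneg_of_hasNonnegSums hd hsup
  have q₀ : 0 ≤ q 0 := hqn 0 0
  have q₁ : 0 ≤ q 1 := hqn 0 1
  have q₂ : 0 ≤ q 2 := hqn 0 2
  have hT : 0 < x 0 + x 1 + x 2 := (hxs 0).2.2
  have hzero : ¬ 0 < q 0 + q 1 + q 2 := by
    intro hpos
    set ρ := (q 0 + q 1 + q 2) / (x 0 + x 1 + x 2) with hρ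
    have hρ0 : 0 < ρ := div_pos hpos hT
    -- The 4 is a product of two losses of a factor 2 from `sum_le_of_ne`, one for `x` and one for
    -- `q`. It suffices to work at a later rank `m` where the branch changes.
    have hmore : sSup S + ρ / 4 ∈ S := by
      intro n
      obtain ⟨k, hk⟩ := hd n
      refine HasNonnegSums.orbit_of_le (n := n + 2 * k) (by omega) ?_
      have e : p - (sSup S + ρ / 4) • x = q - (ρ / 4) • x := by rw [hq, add_smul, sub_sub]
      rw [e, orbit_sub_smul]
      set m := n + 2 * k
      obtain ⟨s₁, s₂⟩ := sum_le_of_ne hqn hk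
      have x₀ := (hx m 0).le
      have x₁ := (hx m 1).le
      have x₂ := (hx m 2).le
      obtain ⟨t₁, t₂⟩ := sum_le_of_ne (fun n i => (hx n i).le) hk
      have z₀ := hqn m 0
      have z₁ := hqn m 1
      have z₂ := hqn m 2
      -- By the choice of `ρ` the total of `ρ • x - q` vanishes at rank 0, so its sums cannot all be
      -- positive at rank `m`.
      have hnot : ¬ HasPosSums (orbit d m (ρ • x - (1 : ℝ) • q)) := by
        intro h
        have := h.of_orbit.2.2
        have hρ' : ρ * (x 0 + x 1 + x 2) = q 0 + q 1 + q 2 := div_mul_cancel₀ _ hT.ne'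
        simp only [one_smul, Pi.sub_apply, Pi.smul_apply, smul_eq_mul] at this
        linarith
      rw [orbit_sub_smul, orbit_smul] at hnot
      simp only [HasPosSums, one_smul, Pi.sub_apply, Pi.smul_apply, smul_eq_mul] at hnot
      have hr₀ := mul_nonneg hρ0.le x₀
      have hr₁ := mul_nonneg hρ0.le x₁
      have hr₂ := mul_nonneg hρ0.le x₂
      have t₁' := mul_le_mul_of_nonneg_left t₁ hρ0.le
      have t₂' := mul_le_mul_of_nonneg_left t₂ hρ0.le
      have hbig : ρ * (orbit d m x 0 + orbit d m x 1 + orbit d m x 2) ≤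
          2 * (orbit d m q 0 + orbit d m q 1 + orbit d m q 2) := by
        by_contra hlt
        exact hnot ⟨by linarith, by linarith, by linarith⟩
      simp only [HasNonnegSums, Pi.sub_apply, Pi.smul_apply, smul_eq_mul]
      exact ⟨by linarith, by linarith, by linarith⟩
    have := le_csSup hbdd hmore
    linarith
  have hq0 : q = 0 := by
    funext i
    rcases letter_cases i with rfl | rfl | rfl <;> simp only [Pi.zero_apply] <;> linarith
  exact sub_eq_zero.1 hq0

/-! ### Uniform approximation by compactness -/

/-- The normalized vectors whose first `n` images under the algorithm are nonnegative. -/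
def approximants (d : ℕ → Bool) (n : ℕ) : Set (Fin 3 → ℝ) :=
  {v | v ∈ stdSimplex ℝ (Fin 3) ∧ ∀ j ≤ n, ∀ i, 0 ≤ orbit d j v i}

theorem approximants_antitone (d : ℕ → Bool) : Antitone (approximants d) :=
  fun _ _ hmn _ hv => ⟨hv.1, fun j hj => hv.2 j (hj.trans hmn)⟩

theorem isCompact_approximants (d : ℕ → Bool) (n : ℕ) : IsCompact (approximants d n) := by
  have hc : IsClosed {v : Fin 3 → ℝ | ∀ j ≤ n, ∀ i, 0 ≤ orbit d j v i} := by
    simp only [Set.ofPred_forall]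
    refine isClosed_iInter fun j => isClosed_iInter fun _ => isClosed_iInter fun i => ?_
    exact isClosed_le continuous_const ((continuous_apply i).comp (continuous_orbit d j))
  exact (isCompact_stdSimplex ℝ (Fin 3)).inter_right hc

theorem exists_approximants_subset {x : Fin 3 → ℝ} (hx : ∀ n i, 0 < orbit d n x i)
    (hsum : ∑ i, x i = 1) {ε : ℝ} (hε : 0 < ε) :
    ∃ n, ∀ v ∈ approximants d n, ∀ i, |v i - x i| < ε := by
  obtain ⟨n, hn⟩ := exists_subset_nhds_of_isCompact' (V := approximants d)
    (U := Metric.ball x ε) (approximants_antitone d).directed_ge (isCompact_approximants d)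
    (fun n => (isCompact_approximants d n).isClosed) (by
      intro v hv
      rw [Set.mem_iInter] at hv
      obtain ⟨t, rfl⟩ := exists_eq_smul_of_orbit_nonneg hx fun n i => (hv n).2 n le_rfl i
      have ht : t = 1 := by
        have := (hv 0).1.2
        simpa only [Pi.smul_apply, smul_eq_mul, ← Finset.mul_sum, hsum, mul_one] using this
      rw [ht, one_smul]
      exact Metric.ball_mem_nhds x hε)
  refine ⟨n, fun v hv i => ?_⟩
  have := hn hv
  rw [Metric.mem_ball] at this
  exact (dist_le_pi_dist v x i).trans_lt this

/-! ### Existence of an infinite word with a given primitive directive sequence -/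

section Existence

variable {A : Type*} {s : ℕ → Substitution A}

theorem compose_prefix {r k : ℕ} {u v : List A} (h : u <+: v) :
    compose s r k u <+: compose s r k v := by
  obtain ⟨q, rfl⟩ := h
  rw [compose_append]
  exact List.prefix_append _ _

/-- A compactness argument: `a n` is the limit along an ultrafilter of the first letters of the
images taken from rank `n` to rank `m`, as `m` grows. -/
theorem exists_coherent_letters [Finite A] [Nonempty A] (hs : ∀ n a, s n a ≠ []) :
    ∃ a : ℕ → A, ∀ n, [a n] <+: s n (a (n + 1)) := by
  obtain ⟨c⟩ := ‹Nonempty A›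
  have hhead : ∀ n m, ∃ b, [b] <+: compose s n (m - n) [c] := by
    intro n m
    obtain ⟨b, y, h⟩ := List.exists_cons_of_ne_nil
      (compose_ne_nil hs (r := n) (k := m - n) (List.cons_ne_nil c []))
    exact ⟨b, y, h.symm⟩
  choose H hH using hhead
  have hlim : ∀ n, ∃ b, ∀ᶠ m in (hyperfilter ℕ : Filter ℕ), H n m = b := by
    intro n
    obtain ⟨b, hb⟩ := Ultrafilter.eq_pure_of_finite ((hyperfilter ℕ).map (H n))
    refine ⟨b, ?_⟩
    have : ({b} : Set A) ∈ (hyperfilter ℕ).map (H n) := by rw [hb]; exact rfl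
    exact this
  choose a ha using hlim
  refine ⟨a, fun n => ?_⟩
  have hlt : ∀ᶠ m in (hyperfilter ℕ : Filter ℕ), n < m :=
    Nat.hyperfilter_le_atTop (eventually_gt_atTop n)
  obtain ⟨m, h₁, h₂, hm⟩ := ((ha n).and ((ha (n + 1)).and hlt)).exists
  obtain ⟨k, rfl⟩ := Nat.exists_eq_add_of_lt hm
  have p₁ := hH n (n + k + 1)
  have p₂ := hH (n + 1) (n + k + 1)
  rw [h₁, show n + k + 1 - n = k + 1 by omega, compose_succ'] at p₁
  rw [h₂, show n + k + 1 - (n + 1) = k by omega] at p₂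
  obtain ⟨q, hq⟩ := p₂
  rw [← hq, List.singleton_append, List.flatMap_cons] at p₁
  obtain ⟨d, y, hy⟩ := List.exists_cons_of_ne_nil (hs n (a (n + 1)))
  rw [hy] at p₁ ⊢
  simpa using p₁

theorem exists_le_length_compose (hs : ∀ n a, s n a ≠ []) (hp : IsPrimitive s) {x y : A}
    (hxy : x ≠ y) (N : ℕ) : ∃ k, ∀ b, N ≤ (compose s 0 k [b]).length := by
  classical
  induction N with
  | zero => exact ⟨0, fun b => Nat.zero_le _⟩
  | succ N ih =>
    obtain ⟨k, hk⟩ := ih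
    obtain ⟨r', -, h'⟩ := hp (0 + k)
    refine ⟨k + (r' - (0 + k)), fun b => ?_⟩
    rw [compose_add]
    set z := compose s (0 + k) (r' - (0 + k)) [b] with hz
    have hlen : 2 ≤ z.length := by
      rw [← Finset.card_pair hxy]
      exact (Finset.card_le_card fun c _ => List.mem_toFinset.2 (h' b c)).trans
        (List.toFinset_card_le _)
    match z, hlen with
    | c :: e :: t, _ =>
      have hsplit : c :: e :: t = [c] ++ ([e] ++ t) := rfl
      rw [hsplit, compose_append, compose_append]
      have h₁ := hk c
      have h₂ := List.length_pos_of_ne_nil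
        (compose_ne_nil hs (r := 0) (k := k) (List.cons_ne_nil e []))
      simp only [List.length_append]
      omega

theorem exists_isRepresentation [Finite A] (hs : ∀ n a, s n a ≠ []) (hp : IsPrimitive s)
    {x y : A} (hxy : x ≠ y) : ∃ a w : ℕ → A, IsRepresentation s a w := by
  have : Nonempty A := ⟨x⟩
  obtain ⟨a, ha⟩ := exists_coherent_letters hs
  have hstep : ∀ n, compose s 0 n [a n] <+: compose s 0 (n + 1) [a (n + 1)] := by
    intro n
    rw [compose]
    refine compose_prefix ?_
    simpa using ha n
  have hmono : ∀ m n, m ≤ n → compose s 0 m [a m] <+: compose s 0 n [a n] := by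
    intro m n hmn
    induction n, hmn using Nat.le_induction with
    | base => exact List.prefix_rfl
    | succ n _ ih => exact ih.trans (hstep n)
  have hlong : ∀ N, ∃ n, N < (compose s 0 n [a n]).length := fun N =>
    (exists_le_length_compose hs hp hxy (N + 1)).imp fun k hk => hk _
  choose n hn using hlong
  refine ⟨a, fun i => (compose s 0 (n i) [a (n i)])[i]'(hn i), fun L => ?_⟩
  filter_upwards [eventually_ge_atTop (n L)] with m hm
  have hL : L ≤ (compose s 0 m [a m]).length := (hn L).le.trans (hmono _ _ hm).length_le
  have : window (fun i => (compose s 0 (n i) [a (n i)])[i]'(hn i)) 0 L =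
      (compose s 0 m [a m]).take L := by
    refine List.ext_getElem (by simp [hL]) fun i h₁ h₂ => ?_
    simp only [window, List.getElem_map, List.getElem_range, List.getElem_take, zero_add]
    rcases le_total (n i) m with h | h
    · exact (hmono _ _ h).getElem (hn i)
    · exact ((hmono _ _ h).getElem (by rw [length_window] at h₁; omega)).symm
  rw [this]
  exact List.take_prefix _ _

end Existence

/-! ### Letter counts of blocks, primitivity and frequencies -/

section Frequency

/-- The vector of the numbers of occurrences of the letters in a word. -/
def countVector (u : List (Fin 3)) : Fin 3 → ℝ := fun i => (u.count i : ℝ)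

theorem sum_countVector (u : List (Fin 3)) : ∑ i, countVector u i = u.length := by
  rw [Fin.sum_univ_three]
  simp only [countVector]
  norm_cast
  induction u with
  | nil => rfl
  | cons a u ih =>
    rcases letter_cases a with rfl | rfl | rfl <;> simp <;> omega

theorem count_flatMap_c₁ (u : List (Fin 3)) :
    (u.flatMap c₁).count 0 = u.count 0 + u.count 1 ∧ (u.flatMap c₁).count 1 = u.count 2 ∧
      (u.flatMap c₁).count 2 = u.count 1 := by
  induction u with
  | nil => simp
  | cons a u ih =>
    rcases letter_cases a with rfl | rfl | rfl <;> simp [ih] <;> omega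

theorem count_flatMap_c₂ (u : List (Fin 3)) :
    (u.flatMap c₂).count 0 = u.count 1 ∧ (u.flatMap c₂).count 1 = u.count 0 ∧
      (u.flatMap c₂).count 2 = u.count 1 + u.count 2 := by
  induction u with
  | nil => simp
  | cons a u ih =>
    rcases letter_cases a with rfl | rfl | rfl <;> simp [ih] <;> omega

/-- The directive sequence over `𝒞` encoded by a sequence of booleans. -/
def directive (d : ℕ → Bool) : ℕ → Substitution (Fin 3) := fun n => bif d n then c₁ else c₂

theorem directive_mem (d : ℕ → Bool) (n : ℕ) : directive d n ∈ cassaigneSet := by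
  cases h : d n <;> simp [directive, h, cassaigneSet]

theorem pull_countVector (d : ℕ → Bool) (n : ℕ) (u : List (Fin 3)) :
    pull (d n) (countVector (u.flatMap (directive d n))) = countVector u := by
  obtain ⟨h₁, h₂, h₃⟩ := count_flatMap_c₁ u
  obtain ⟨k₁, k₂, k₃⟩ := count_flatMap_c₂ u
  funext i
  cases h : d n <;> rcases letter_cases i with rfl | rfl | rfl <;>
    simp [directive, h, countVector, h₁, h₂, h₃, k₁, k₂, k₃]

theorem orbit_countVector (d : ℕ → Bool) (r j k : ℕ) (u : List (Fin 3)) :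
    orbit (fun n => d (r + n)) j (countVector (compose (directive d) r (j + k) u)) =
      countVector (compose (directive d) (r + j) k u) := by
  induction j generalizing k with
  | zero => rw [zero_add]; rfl
  | succ j ih =>
    rw [orbit, show j + 1 + k = j + (k + 1) by ring, ih, compose_succ', pull_countVector]
    rfl

theorem compose_directive_ne_nil (d : ℕ → Bool) (r k : ℕ) (a : Fin 3) :
    compose (directive d) r k [a] ≠ [] :=
  compose_ne_nil (fun n => ne_nil_of_mem_cassaigneSet (directive_mem d n)) (List.cons_ne_nil a [])

theorem normalized_countVector_mem (d : ℕ → Bool) (r k : ℕ) (a : Fin 3) :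
    ((compose (directive d) r k [a]).length : ℝ)⁻¹ • countVector (compose (directive d) r k [a]) ∈
      approximants (fun n => d (r + n)) k := by
  have hpos : (0 : ℝ) < (compose (directive d) r k [a]).length :=
    Nat.cast_pos.2 (List.length_pos_of_ne_nil (compose_directive_ne_nil d r k a))
  refine ⟨⟨fun i => ?_, ?_⟩, fun j hj i => ?_⟩
  · exact mul_nonneg (inv_nonneg.2 hpos.le) (Nat.cast_nonneg _)
  · simp only [Pi.smul_apply, smul_eq_mul, ← Finset.mul_sum, sum_countVector]
    exact inv_mul_cancel₀ hpos.ne'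
  · obtain ⟨l, rfl⟩ := Nat.exists_eq_add_of_le hj
    rw [orbit_smul, orbit_countVector]
    exact mul_nonneg (inv_nonneg.2 hpos.le) (Nat.cast_nonneg _)

theorem isPrimitive_directive {d : ℕ → Bool} {x : Fin 3 → ℝ} (hx : ∀ n i, 0 < orbit d n x i) :
    IsPrimitive (directive d) := by
  intro r
  set S := ∑ i, orbit d r x i with hS
  have hSpos : 0 < S := Finset.sum_pos (fun i _ => hx r i) ⟨0, Finset.mem_univ 0⟩
  set y := S⁻¹ • orbit d r x with hy
  have hypos : ∀ n i, 0 < orbit (fun k => d (r + k)) n y i := by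
    intro n i
    rw [hy, orbit_smul, ← orbit_add]
    exact mul_pos (inv_pos.2 hSpos) (hx _ i)
  have hysum : ∑ i, y i = 1 := by
    simp only [hy, Pi.smul_apply, smul_eq_mul, ← Finset.mul_sum, ← hS]
    exact inv_mul_cancel₀ hSpos.ne'
  have hy0 : ∀ i, 0 < y i := hypos 0
  obtain ⟨ε, hε, hεy⟩ : ∃ ε > 0, ∀ i, ε ≤ y i :=
    ⟨min (y 0) (min (y 1) (y 2)), lt_min (hy0 0) (lt_min (hy0 1) (hy0 2)), fun i => by
      rcases letter_cases i with rfl | rfl | rfl <;> simp⟩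
  -- A normalized count vector within less than the smallest entry of `y` has no zero entry, so
  -- every letter occurs.
  obtain ⟨n, hn⟩ := exists_approximants_subset hypos hysum hε
  refine ⟨r + (n + 1), by omega, fun a b => ?_⟩
  rw [Nat.add_sub_cancel_left]
  have h := hn _ (approximants_antitone _ (Nat.le_succ n)
    (normalized_countVector_mem d r (n + 1) a)) b
  rw [abs_lt] at h
  have hpos : 0 < ((compose (directive d) r (n + 1) [a]).length : ℝ)⁻¹ *
      ((compose (directive d) r (n + 1) [a]).count b : ℝ) := by
    have h₁ := h.1
    simp only [Pi.smul_apply, smul_eq_mul, countVector] at h₁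
    linarith [hεy b]
  refine List.count_pos_iff.1 (Nat.pos_of_ne_zero fun h0 => ?_)
  rw [h0] at hpos
  simp at hpos

/-- Complete blocks contribute in proportion to their length; the incomplete last block costs at
most `M`, once. -/
theorem abs_count_sub_le {B : Type*} {f : B → List (Fin 3)} {i : Fin 3} {ξ ε M : ℝ}
    (hξ : 0 ≤ ξ) (hξ' : ξ ≤ 1) (hε : 0 ≤ ε) (hM : ∀ b, ((f b).length : ℝ) ≤ M)
    (hM0 : 0 ≤ M) (hf : ∀ b, |((f b).count i : ℝ) - ξ * (f b).length| ≤ ε * (f b).length)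
    {l : List B} {u : List (Fin 3)} (h : u <+: l.flatMap f) :
    |(u.count i : ℝ) - ξ * u.length| ≤ ε * u.length + M := by
  have short : ∀ u : List (Fin 3), (u.length : ℝ) ≤ M →
      |(u.count i : ℝ) - ξ * u.length| ≤ ε * u.length + M := by
    intro u hu
    have h₁ : (u.count i : ℝ) ≤ u.length := Nat.cast_le.2 List.count_le_length
    have h₂ : (0 : ℝ) ≤ u.count i := Nat.cast_nonneg _
    have h₃ : (0 : ℝ) ≤ u.length := Nat.cast_nonneg _
    have h₄ := mul_nonneg hε h₃
    have h₅ := mul_nonneg hξ h₃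
    have h₆ := mul_le_mul_of_nonneg_right hξ' h₃
    rw [abs_le]
    constructor <;> linarith
  induction l generalizing u with
  | nil =>
    obtain rfl : u = [] := by simpa using h
    simpa using hM0
  | cons b l ih =>
    rw [List.flatMap_cons] at h
    obtain ⟨q, hq⟩ := h
    rcases List.append_eq_append_iff.1 hq with ⟨t, ht, -⟩ | ⟨u', rfl, h'⟩
    · have hpre : u <+: f b := ⟨t, ht.symm⟩
      exact short u ((Nat.cast_le.2 hpre.length_le).trans (hM b))
    · have h₁ := abs_le.1 (ih ⟨q, h'.symm⟩)
      have h₂ := abs_le.1 (hf b)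
      rw [abs_le]
      simp only [List.count_append, List.length_append]
      push_cast
      constructor <;> linarith [h₁.1, h₁.2, h₂.1, h₂.2]

theorem hasFrequency_of_isRepresentation {d : ℕ → Bool} {x : Fin 3 → ℝ}
    (hx : ∀ n i, 0 < orbit d n x i) (hsum : ∑ i, x i = 1) {a w : ℕ → Fin 3}
    (h : IsRepresentation (directive d) a w) (i : Fin 3) : HasFrequency w i (x i) := by
  rw [HasFrequency, Metric.tendsto_atTop]
  intro ε hε
  obtain ⟨k, hk⟩ := exists_approximants_subset hx hsum (half_pos hε)
  obtain ⟨M, hM, hMb⟩ := exists_length_compose_le (directive d) 0 k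
  have hblock : ∀ b, |((compose (directive d) 0 k [b]).count i : ℝ) -
      x i * (compose (directive d) 0 k [b]).length| ≤
      ε / 2 * (compose (directive d) 0 k [b]).length := by
    intro b
    have hpos : (0 : ℝ) < (compose (directive d) 0 k [b]).length :=
      Nat.cast_pos.2 (List.length_pos_of_ne_nil (compose_directive_ne_nil d 0 k b))
    have hmem := normalized_countVector_mem d 0 k b
    simp only [zero_add] at hmem
    have hb := (hk _ hmem i).le
    have e : ((compose (directive d) 0 k [b]).count i : ℝ) -
        x i * (compose (directive d) 0 k [b]).length =
        ((((compose (directive d) 0 k [b]).length : ℝ)⁻¹ •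
          countVector (compose (directive d) 0 k [b])) i - x i) *
        (compose (directive d) 0 k [b]).length := by
      simp only [Pi.smul_apply, smul_eq_mul, countVector]
      field_simp
    rw [e, abs_mul, abs_of_pos hpos]
    exact mul_le_mul_of_nonneg_right hb hpos.le
  have hx0 : ∀ j, 0 < x j := hx 0
  have hx1 : x i ≤ 1 := by
    rw [← hsum]
    exact Finset.single_le_sum (fun j _ => (hx0 j).le) (Finset.mem_univ i)
  obtain ⟨N, hN⟩ := exists_nat_gt ((M : ℝ) / (ε / 2))
  refine ⟨N + 1, fun n hn => ?_⟩
  have hn0 : (0 : ℝ) < n := Nat.cast_pos.2 (by omega)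
  have hNn : (N : ℝ) < n := Nat.cast_lt.2 (by omega)
  obtain ⟨l, hl⟩ := h.exists_prefix k n
  have hb := abs_count_sub_le (hx0 i).le hx1 (half_pos hε).le
    (fun b => Nat.cast_le.2 (hMb b)) (Nat.cast_nonneg M) hblock hl
  rw [length_window] at hb
  rw [Real.dist_eq]
  have e : ((window w 0 n).count i : ℝ) / n - x i =
      (((window w 0 n).count i : ℝ) - x i * n) / n := by field_simp
  rw [e, abs_div, abs_of_pos hn0, div_lt_iff₀ hn0]
  rw [div_lt_iff₀ (half_pos hε)] at hN
  have := mul_lt_mul_of_pos_right hNn (half_pos hε)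
  linarith

end Frequency

/-! ### The itinerary of a rationally independent vector -/

section Itinerary

/-- The orbit of `x` under Cassaigne's algorithm. -/
noncomputable def itineraryPoint (x : Fin 3 → ℝ) : ℕ → Fin 3 → ℝ
  | 0 => x
  | n + 1 => pull (decide (itineraryPoint x n 2 < itineraryPoint x n 0)) (itineraryPoint x n)

/-- The branches of Cassaigne's algorithm followed by `x`. -/
noncomputable def itinerary (x : Fin 3 → ℝ) (n : ℕ) : Bool :=
  decide (itineraryPoint x n 2 < itineraryPoint x n 0)

theorem orbit_itinerary (x : Fin 3 → ℝ) (n : ℕ) :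
    orbit (itinerary x) n x = itineraryPoint x n := by
  induction n with
  | zero => rfl
  | succ n ih => rw [orbit, ih]; rfl

theorem linearIndependent_triple {x : Fin 3 → ℝ} :
    LinearIndependent ℚ x ↔ ∀ a b c : ℚ, (a : ℝ) * x 0 + b * x 1 + c * x 2 = 0 →
      a = 0 ∧ b = 0 ∧ c = 0 := by
  rw [Fintype.linearIndependent_iff]
  constructor
  · intro h a b c habc
    have := h ![a, b, c] (by simpa [Fin.sum_univ_three, Rat.smul_def] using habc)
    exact ⟨this 0, this 1, this 2⟩
  · intro h g hg i
    have := h (g 0) (g 1) (g 2) (by simpa [Fin.sum_univ_three, Rat.smul_def] using hg)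
    rcases letter_cases i with rfl | rfl | rfl
    · exact this.1
    · exact this.2.1
    · exact this.2.2

theorem linearIndependent_pull {x : Fin 3 → ℝ} (h : LinearIndependent ℚ x) (b : Bool) :
    LinearIndependent ℚ (pull b x) := by
  rw [linearIndependent_triple] at h ⊢
  intro p q r hpqr
  cases b
  · simp at hpqr
    have := h (q - r) p r (by push_cast; linarith)
    exact ⟨this.2.1, by linarith [this.1, this.2.2], this.2.2⟩
  · simp at hpqr
    have := h p r (q - p) (by push_cast; linarith)
    exact ⟨this.1, by linarith [this.1, this.2.2], this.2.1⟩

theorem itineraryPoint_pos {x : Fin 3 → ℝ} (hx : ∀ i, 0 ≤ x i) (h : LinearIndependent ℚ x)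
    (n : ℕ) : LinearIndependent ℚ (itineraryPoint x n) ∧ ∀ i, 0 < itineraryPoint x n i := by
  induction n with
  | zero => exact ⟨h, fun i => (hx i).lt_of_ne (h.ne_zero i).symm⟩
  | succ n ih =>
    obtain ⟨hi, hpos⟩ := ih
    refine ⟨linearIndependent_pull hi _, ?_⟩
    -- Rational independence, preserved by the algorithm, excludes a tie, so the subtraction leaves
    -- a positive entry.
    have hne : itineraryPoint x n 0 ≠ itineraryPoint x n 2 := fun he =>
      absurd (hi.injective he) (by decide)
    intro i
    rw [itineraryPoint]
    rcases hne.lt_or_gt with hlt | hlt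
    · rw [decide_eq_false hlt.not_gt]
      rcases letter_cases i with rfl | rfl | rfl <;> simp [hpos, hlt]
    · rw [decide_eq_true hlt]
      rcases letter_cases i with rfl | rfl | rfl <;> simp [hpos, hlt]

theorem exists_isPrimitiveSAdic_hasFrequency {x : Fin 3 → ℝ} (hx : ∀ i, 0 ≤ x i)
    (hsum : ∑ i, x i = 1) (h : LinearIndependent ℚ x) :
    ∃ w, IsPrimitiveSAdic cassaigneSet w ∧ ∀ i, HasFrequency w i (x i) := by
  have hpos : ∀ n i, 0 < orbit (itinerary x) n x i := by
    intro n i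
    rw [orbit_itinerary]
    exact (itineraryPoint_pos hx h n).2 i
  have hp := isPrimitive_directive hpos
  have hmem := directive_mem (itinerary x)
  obtain ⟨a, w, hr⟩ := exists_isRepresentation
    (fun n => ne_nil_of_mem_cassaigneSet (hmem n)) hp (x := (0 : Fin 3)) (y := 1) (by decide)
  exact ⟨w, ⟨_, a, hmem, hp, hr⟩, hasFrequency_of_isRepresentation hpos hsum hr⟩

end Itinerary

theorem IsPrimitiveSAdic.isUniformlyRecurrent {A : Type*} [Finite A] {S : Set (Substitution A)}
    {w : ℕ → A} (h : IsPrimitiveSAdic S w) : IsUniformlyRecurrent w := by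
  obtain ⟨s, a, -, hp, hr⟩ := h
  exact hr.isUniformlyRecurrent hp

end SAdic

theorem proposition1 :
    (∀ w : ℕ → Fin 3, SAdic.IsPrimitiveSAdic SAdic.cassaigneSet w →
      SAdic.IsUniformlyRecurrent w ∧ SAdic.IsTreeWord w) ∧
    (∀ w : ℕ → Fin 3, SAdic.IsPrimitiveSAdic SAdic.cassaigneSet w →
      ∀ n : ℕ, SAdic.complexity w n = 2 * n + 1) ∧
    (∀ x : Fin 3 → ℝ, (∀ i, 0 ≤ x i) → ∑ i, x i = 1 → LinearIndependent ℚ x →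
      ∃ w : ℕ → Fin 3, SAdic.IsPrimitiveSAdic SAdic.cassaigneSet w ∧
        (∀ n : ℕ, SAdic.complexity w n = 2 * n + 1) ∧
        ∀ i, SAdic.HasFrequency w i (x i)) := by
  have hcomplexity : ∀ w, SAdic.IsPrimitiveSAdic SAdic.cassaigneSet w →
      ∀ n, SAdic.complexity w n = 2 * n + 1 := fun _ h => h.complexity_eq
  refine ⟨fun w h => ⟨h.isUniformlyRecurrent, h.isTreeWord⟩, hcomplexity, fun x hx hsum hi => ?_⟩
  obtain ⟨w, hw, hf⟩ := SAdic.exists_isPrimitiveSAdic_hasFrequency hx hsum hi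
  exact ⟨w, hw, hcomplexity w hw, hf⟩
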